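/- For a finite simple graph $G$ let $C(G)=\sum_i\sum_{j\ne i}2^{-d(i,j)}$ be its closeness, where $i,j$ range over the vertices, $d$ is the graph distance, and $2^{-\infty}=0$. Its link residual closeness is $R(G)=\min_e C(G-e)$, the minimum being over the edges $e$ of $G$. For $1\le m<n$ let $H_{2m+1,2n+1}$ be the Harary graph with vertices $1,2,\dots,2n+1$ placed on a circle in this order, in which every vertex is joined to the nearest $m$ vertices in each direction and, in addition, $i$ is joined to $i+n$ for $1\le i\le n+1$. Let $m>2$ and suppose that $p=\left\lfloor\frac{n+m-1}{2m}\right\rfloor>1$. Then $$R(H_{2m+1,2n+1})=C(H_{2m+1,2n+1})-4+(3p+4)2^{-p},$$ and the minimum that defines $R(H_{2m+1,2n+1})$ is attained by deleting the edge $(n,n+m)$. -/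

import Mathlib

/-- Contribution `2^{-d(i,j)}` of an ordered pair of vertices; it is `0` when `i` and `j` lie in
different components (infinite distance). -/
noncomputable def pairCloseness {V : Type*} (G : SimpleGraph V) (i j : V) : ℝ :=
  open Classical in if G.Reachable i j then (2 : ℝ) ^ (-(G.dist i j : ℤ)) else 0

/-- The closeness `C(G) = ∑_i ∑_{j ≠ i} 2^{-d(i,j)}` of a finite simple graph. -/
noncomputable def closeness {V : Type*} [Fintype V] [DecidableEq V] (G : SimpleGraph V) : ℝ :=
  ∑ i : V, ∑ j ∈ Finset.univ.erase i, pairCloseness G i j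

/-- The closenesses of all graphs obtained from `G` by removing exactly one of its links. -/
def linkDeletedClosenesses {V : Type*} [Fintype V] [DecidableEq V] (G : SimpleGraph V) : Set ℝ :=
  {c | ∃ e ∈ G.edgeSet, c = closeness (G.deleteEdges {e})}

/-- The link residual closeness `R(G)`: the minimum, over the links of `G`, of the closeness of the
graph with that link removed (a finite set of reals, so that the infimum is a minimum as soon as
`G` has a link). -/
noncomputable def linkResidualCloseness {V : Type*} [Fintype V] [DecidableEq V]
    (G : SimpleGraph V) : ℝ :=
  sInf (linkDeletedClosenesses G)

/-- The infimum in the definition of `R(G)` is a minimum for every graph with at least one link. -/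
theorem isLeast_linkResidualCloseness {V : Type*} [Fintype V] [DecidableEq V]
    (G : SimpleGraph V) (h : G.edgeSet.Nonempty) :
    IsLeast (linkDeletedClosenesses G) (linkResidualCloseness G) := by
  have hfin : (linkDeletedClosenesses G).Finite := by
    refine (Set.toFinite ((fun e => closeness (G.deleteEdges {e})) '' G.edgeSet)).subset ?_
    rintro c ⟨e, he, rfl⟩
    exact ⟨e, he, rfl⟩
  obtain ⟨e, he⟩ := h
  exact ⟨Set.Nonempty.csInf_mem ⟨_, e, he, rfl⟩ hfin, fun c hc => csInf_le hfin.bddBelow hc⟩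

/-- The name of a vertex on the circle: the vertices are named `1, 2, …, N` in cyclic order. -/
def vertexLabel {N : ℕ} (i : Fin N) : ℕ := i.val + 1

/-- The number of steps between two vertices along the shorter arc of the circle. -/
def circleDist {N : ℕ} (i j : Fin N) : ℕ :=
  min (Nat.dist (vertexLabel i) (vertexLabel j)) (N - Nat.dist (vertexLabel i) (vertexLabel j))

/-- The Harary graph `H_{k,N}` (for `2 ≤ k < N`). Every vertex is linked to the nearest `⌊k/2⌋`
vertices in each direction; if `k` is odd, the links `(i, i + ⌊N/2⌋)` are added for all `i` such
that both `i` and `i + ⌊N/2⌋` are in `{1, …, N}`. For `N = 2q` these are the `q` diameters, for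
`N = 2q + 1` they are the links `(i, i + q)` with `i ∈ [1, q + 1]`. -/
def hararyGraph (k N : ℕ) : SimpleGraph (Fin N) where
  Adj i j := i ≠ j ∧ (circleDist i j ≤ k / 2 ∨
    (Odd k ∧ (vertexLabel i + N / 2 = vertexLabel j ∨ vertexLabel j + N / 2 = vertexLabel i)))
  symm := ⟨by
    rintro i j ⟨hne, h⟩
    refine ⟨hne.symm, ?_⟩
    rcases h with h | ⟨hk, h⟩
    · left
      simpa only [circleDist, Nat.dist_comm] using h
    · exact Or.inr ⟨hk, h.symm⟩⟩
  loopless := ⟨fun i h => h.1 rfl⟩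

/-! Number the positions from 0 modulo `2 * n + 1`. Short links are displacements by 1, …, `m`; long
links join `z` to `z + n` for `0 ≤ z ≤ n`, so only position `n` has two. The value of `p` means `2pm
+ 1 ≤ n + m` and `n ≤ 2pm + m`, which bounds the diameter by `p + 1`. A pair loses closeness exactly
when all its shortest walks use the deleted link.

For a link `(u, u + m)`, a walk that cannot be rerouted at no cost has all its short steps of length
`m` and at most one long link. For `a + b = k < p` the candidates, at distance `k + 1`, are: `u -
am` and `u + m + bm` (`k + 1` pairs); if `u < n`, `u - am` and `u - n + bm` with `b ≥ 1`, where the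
long link is taken at `u + m` (`k` pairs); if `u + m > n`, the mirror images `u + m + bm` and `u + n
+ m - am` with `a ≥ 1` (`k` pairs). Two short steps replace the deleted link, so an affected pair
loses at most `2^-(k+2)`. For `u = n - 1` all three families are affected, and over ordered pairs
the loss is `2 (∑ (k+1) 2^-(k+2) + 2 ∑ k 2^-(k+2)) = 4 - (3p + 4) 2^-p`, sums over `k < p`.

No other link costs more. If a mixed family is absent, some pairs at distance `p + 1` may enter, but
too few to compensate. A link shorter than `m` matters only to its own ends, and a long link to its
ends and at most `2p` further pairs. The upper bounds rest on `cutHarary_affected` and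
`cutHarary_long_affected`; the lower bound for `u = n - 1` rests on the description of balls in
`cutHarary_within_subset`. -/

/-- `y` can be reached from `x` by a walk of at most `k` steps. -/
def SimpleGraph.Within {V : Type*} (H : SimpleGraph V) (k : ℕ) (x y : V) : Prop :=
  ∃ w : H.Walk x y, w.length ≤ k

/-! ### Walks of bounded length and passages through an edge -/

namespace SimpleGraph

variable {V : Type*} {H : SimpleGraph V} {k l : ℕ} {x y z : V}

theorem Within.refl (H : SimpleGraph V) (k : ℕ) (x : V) : H.Within k x x := ⟨.nil, by simp⟩

theorem Within.of_adj (h : H.Adj x y) : H.Within 1 x y := ⟨h.toWalk, by simp⟩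

theorem Within.symm (h : H.Within k x y) : H.Within k y x := by
  obtain ⟨w, hw⟩ := h
  exact ⟨w.reverse, by simpa using hw⟩

theorem Within.trans (h : H.Within k x y) (h' : H.Within l y z) : H.Within (k + l) x z := by
  obtain ⟨w, hw⟩ := h
  obtain ⟨w', hw'⟩ := h'
  exact ⟨w.append w', by simp; omega⟩

theorem Within.mono (h : H.Within k x y) (hkl : k ≤ l) : H.Within l x y := by
  obtain ⟨w, hw⟩ := h
  exact ⟨w, hw.trans hkl⟩

theorem Within.mono_graph {G : SimpleGraph V} (hG : H ≤ G) (h : H.Within k x y) :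
    G.Within k x y := by
  obtain ⟨w, hw⟩ := h
  exact ⟨w.mapLe hG, by simpa using hw⟩

theorem Within.eq_of_zero (h : H.Within 0 x y) : x = y := by
  obtain ⟨w, hw⟩ := h
  exact SimpleGraph.Walk.eq_of_length_eq_zero (Nat.le_zero.mp hw)

/-- Induction on the last step of a walk. -/
theorem Within.rec_snoc {P : ℕ → V → Prop} {x : V} (h0 : P 0 x)
    (hmono : ∀ k y, P k y → P (k + 1) y)
    (hstep : ∀ k y z, P k y → H.Adj y z → P (k + 1) z) :
    ∀ (k : ℕ) (y : V), H.Within k x y → P k y := by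
  intro k
  induction k with
  | zero =>
    intro y h
    rw [← h.eq_of_zero]; exact h0
  | succ k ih =>
    rintro y ⟨w, hw⟩
    induction w using SimpleGraph.Walk.concatRec with
    | Hnil => exact hmono _ _ (ih _ (Within.refl H k _))
    | Hconcat p h _ =>
      rw [SimpleGraph.Walk.length_concat] at hw
      exact hstep _ _ _ (ih _ ⟨p, by omega⟩) h

/-- A walk in a graph either avoids a given edge, or it splits at a passage through it. -/
theorem Within.split_edge {G : SimpleGraph V} {u v : V} :
    ∀ (k : ℕ) (x y : V), G.Within k x y →
      (G.deleteEdges {s(u, v)}).Within k x y ∨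
      ∃ a b, a + b + 1 ≤ k ∧
        (((G.deleteEdges {s(u, v)}).Within a x u ∧ (G.deleteEdges {s(u, v)}).Within b v y) ∨
         ((G.deleteEdges {s(u, v)}).Within a x v ∧ (G.deleteEdges {s(u, v)}).Within b u y)) := by
  intro k x y ⟨w, hw⟩
  induction w generalizing k with
  | nil => exact Or.inl (Within.refl _ _ _)
  | @cons x z y h w ih =>
    rw [SimpleGraph.Walk.length_cons] at hw
    obtain ⟨k, rfl⟩ : ∃ l, k = l + 1 := ⟨k - 1, by omega⟩
    by_cases he : s(x, z) = s(u, v)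
    · rcases Sym2.eq_iff.mp he with ⟨rfl, rfl⟩ | ⟨rfl, rfl⟩
      -- If the rest of the walk crosses the link again, only its part after that crossing is kept:
      -- it starts at `v`, or already at `u = x`, where no crossing is needed.
      · rcases ih k (by omega) with h1 | ⟨a, b, hab, ⟨-, h2⟩ | ⟨-, h2⟩⟩
        · exact Or.inr ⟨0, k, by omega, Or.inl ⟨Within.refl _ _ _, h1⟩⟩
        · exact Or.inr ⟨0, b, by omega, Or.inl ⟨Within.refl _ _ _, h2⟩⟩
        · exact Or.inl (h2.mono (by omega))
      · rcases ih k (by omega) with h1 | ⟨a, b, hab, ⟨-, h2⟩ | ⟨-, h2⟩⟩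
        · exact Or.inr ⟨0, k, by omega, Or.inr ⟨Within.refl _ _ _, h1⟩⟩
        · exact Or.inl (h2.mono (by omega))
        · exact Or.inr ⟨0, b, by omega, Or.inr ⟨Within.refl _ _ _, h2⟩⟩
    · have hadj : (G.deleteEdges {s(u, v)}).Within 1 x z :=
        Within.of_adj (by simp only [SimpleGraph.deleteEdges_adj]; exact ⟨h, by simpa using he⟩)
      rcases ih k (by omega) with h1 | ⟨a, b, hab, ⟨h1, h2⟩ | ⟨h1, h2⟩⟩
      · exact Or.inl ((hadj.trans h1).mono (by omega))
      · exact Or.inr ⟨1 + a, b, by omega, Or.inl ⟨hadj.trans h1, h2⟩⟩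
      · exact Or.inr ⟨1 + a, b, by omega, Or.inr ⟨hadj.trans h1, h2⟩⟩

/-- If removing a link lengthens the distance `k` between `x` and `y`, then it lengthens the
distances from `x` to the far end of the link and from its near end to `y`. -/
theorem Within.exists_split_of_not {G : SimpleGraph V} {u v : V} (huv : G.Adj u v)
    {k : ℕ} {x y : V} (h : G.Within k x y) (hmin : ∀ j < k, ¬ G.Within j x y)
    (hn : ¬ (G.deleteEdges {s(u, v)}).Within k x y) :
    ∃ a b, a + b + 1 = k ∧
      (((G.deleteEdges {s(u, v)}).Within a x u ∧ (G.deleteEdges {s(u, v)}).Within b v y ∧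
        ¬ (G.deleteEdges {s(u, v)}).Within (a + 1) x v ∧
        ¬ (G.deleteEdges {s(u, v)}).Within (b + 1) u y) ∨
       ((G.deleteEdges {s(u, v)}).Within a x v ∧ (G.deleteEdges {s(u, v)}).Within b u y ∧
        ¬ (G.deleteEdges {s(u, v)}).Within (a + 1) x u ∧
        ¬ (G.deleteEdges {s(u, v)}).Within (b + 1) v y)) := by
  have hle : G.deleteEdges {s(u, v)} ≤ G := SimpleGraph.deleteEdges_le _
  rcases Within.split_edge (u := u) (v := v) k x y h with h1 | ⟨a, b, hab, h1⟩
  · exact absurd h1 hn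
  have hlen : a + b + 1 = k := by
    by_contra hne
    apply hmin (a + 1 + b) (by omega)
    rcases h1 with ⟨h1, h2⟩ | ⟨h1, h2⟩
    · exact ((h1.mono_graph hle).trans (Within.of_adj huv)).trans (h2.mono_graph hle)
    · exact ((h1.mono_graph hle).trans (Within.of_adj huv.symm)).trans (h2.mono_graph hle)
  refine ⟨a, b, hlen, ?_⟩
  rcases h1 with ⟨h1, h2⟩ | ⟨h1, h2⟩
  · exact Or.inl ⟨h1, h2, fun h3 => hn ((h3.trans h2).mono (by omega)),
      fun h3 => hn ((h1.trans h3).mono (by omega))⟩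
  · exact Or.inr ⟨h1, h2, fun h3 => hn ((h3.trans h2).mono (by omega)),
      fun h3 => hn ((h1.trans h3).mono (by omega))⟩

end SimpleGraph

/-! ### Closeness in terms of bounded walks -/

section Closeness

variable {V : Type*} {H : SimpleGraph V} {k : ℕ} {x y : V}

theorem pairCloseness_nonneg (H : SimpleGraph V) (x y : V) : 0 ≤ pairCloseness H x y := by
  unfold pairCloseness; split_ifs <;> positivity

theorem pairCloseness_self (H : SimpleGraph V) (x : V) : pairCloseness H x x = 1 := by
  simp [pairCloseness]

theorem pairCloseness_comm (H : SimpleGraph V) (x y : V) :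
    pairCloseness H x y = pairCloseness H y x := by
  by_cases h : H.Reachable x y
  · simp [pairCloseness, h, h.symm, SimpleGraph.dist_comm (u := x)]
  · have h' : ¬ H.Reachable y x := fun h' => h h'.symm
    simp [pairCloseness, h, h']

theorem pairCloseness_eq (h : H.Within k x y) : pairCloseness H x y = (1 / 2 : ℝ) ^ H.dist x y := by
  obtain ⟨w, -⟩ := h
  rw [pairCloseness, if_pos ⟨w⟩]
  simp [zpow_neg]

theorem SimpleGraph.Within.dist_le (h : H.Within k x y) : H.dist x y ≤ k := by
  obtain ⟨w, hw⟩ := h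
  exact (SimpleGraph.dist_le w).trans hw

theorem SimpleGraph.Within.dist (h : H.Within k x y) : H.Within (H.dist x y) x y := by
  obtain ⟨w, hw⟩ := h
  obtain ⟨w', hw'⟩ := SimpleGraph.Reachable.exists_walk_length_eq_dist ⟨w⟩
  exact ⟨w', hw'.le⟩

theorem SimpleGraph.Within.le_pairCloseness (h : H.Within k x y) :
    (1 / 2 : ℝ) ^ k ≤ pairCloseness H x y := by
  rw [pairCloseness_eq h]
  exact pow_le_pow_of_le_one (by norm_num) (by norm_num) h.dist_le

theorem pairCloseness_le_of_not_within (h : ¬ H.Within k x y) :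
    pairCloseness H x y ≤ (1 / 2 : ℝ) ^ (k + 1) := by
  by_cases hr : H.Reachable x y
  · obtain ⟨w⟩ := hr
    have hw : H.Within w.length x y := ⟨w, le_rfl⟩
    rw [pairCloseness_eq hw]
    refine pow_le_pow_of_le_one (by norm_num) (by norm_num) ?_
    by_contra hlt
    exact h (hw.dist.mono (by omega))
  · rw [pairCloseness, if_neg hr]; positivity

theorem pairCloseness_mono {G : SimpleGraph V} (hG : H ≤ G) (x y : V) :
    pairCloseness H x y ≤ pairCloseness G x y := by
  by_cases hr : H.Reachable x y
  · obtain ⟨w⟩ := hr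
    have hw : H.Within w.length x y := ⟨w, le_rfl⟩
    rw [pairCloseness_eq hw]
    exact (hw.dist.mono_graph hG).le_pairCloseness
  · rw [pairCloseness, if_neg hr]; exact pairCloseness_nonneg _ _ _

/-- Diagonal terms are all 1, so differences of closeness become sums over all ordered pairs. -/
theorem closeness_eq_sum [Fintype V] [DecidableEq V] (H : SimpleGraph V) :
    closeness H = ∑ x : V, ∑ y : V, pairCloseness H x y - Fintype.card V := by
  have h : ∀ x : V, ∑ y ∈ Finset.univ.erase x, pairCloseness H x y =
      ∑ y : V, pairCloseness H x y - 1 := by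
    intro x
    rw [← Finset.add_sum_erase _ _ (Finset.mem_univ x), pairCloseness_self]; ring
  simp [closeness, h]

theorem closeness_sub_closeness [Fintype V] [DecidableEq V] (G H : SimpleGraph V) :
    closeness G - closeness H =
      ∑ i : V × V, (pairCloseness G i.1 i.2 - pairCloseness H i.1 i.2) := by
  rw [closeness_eq_sum, closeness_eq_sum, Finset.sum_sub_distrib, Fintype.sum_prod_type,
    Fintype.sum_prod_type]
  ring

/-- A sum over ordered pairs whose positive terms are dominated by the weights of a family of
unordered pairs. -/
theorem sum_pairs_le_of_cover [Fintype V] {ι : Type*} (f : V × V → ℝ)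
    (T : Finset ι) (g : ι → V × V) (w : ι → ℝ) (hw : ∀ j ∈ T, 0 ≤ w j)
    (hcov : ∀ i, 0 < f i → ∃ j ∈ T, (g j = i ∨ g j = i.swap) ∧ f i ≤ w j) :
    ∑ i, f i ≤ 2 * ∑ j ∈ T, w j := by
  classical
  have h1 : ∀ i, f i ≤ ∑ j ∈ T, ((if g j = i then w j else 0) + if g j = i.swap then w j else 0) := by
    intro i
    have hnn : ∀ j ∈ T, 0 ≤ (if g j = i then w j else 0) + if g j = i.swap then w j else 0 := by
      intro j hj
      have := hw j hj
      split_ifs <;> linarith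
    rcases le_or_gt (f i) 0 with h | h
    · exact h.trans (Finset.sum_nonneg hnn)
    · obtain ⟨j, hj, hg, hf⟩ := hcov i h
      refine le_trans ?_ (Finset.single_le_sum hnn hj)
      have := hw j hj
      rcases hg with hg | hg <;> simp only [hg, if_true] <;> split_ifs <;> linarith
  refine (Finset.sum_le_sum fun i _ => h1 i).trans ?_
  rw [Finset.sum_comm, Finset.mul_sum]
  refine Finset.sum_le_sum fun j _ => le_of_eq ?_
  have h2 : ∀ i : V × V, g j = i.swap ↔ (g j).swap = i := fun i =>
    ⟨fun h => by rw [h, Prod.swap_swap], fun h => by rw [← h, Prod.swap_swap]⟩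
  simp only [h2]
  rw [Finset.sum_add_distrib, Finset.sum_ite_eq, Finset.sum_ite_eq]
  simp; ring

end Closeness

/-! ### Integer positions on the circle -/

/-- The vertex of the circle on `2 * n + 1` points at the integer position `z`. -/
def circlePoint (n : ℕ) (z : ℤ) : Fin (2 * n + 1) :=
  ⟨(z % (2 * n + 1)).toNat, by
    have h1 := Int.emod_nonneg z (b := 2 * (n : ℤ) + 1) (by omega)
    have h2 := Int.emod_lt_of_pos z (b := 2 * (n : ℤ) + 1) (by omega)
    omega⟩

/-- The Harary graph `H_{2m+1,2n+1}`. -/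
abbrev oddHarary (m n : ℕ) : SimpleGraph (Fin (2 * n + 1)) := hararyGraph (2 * m + 1) (2 * n + 1)

section CirclePoint

variable {n : ℕ} {z w : ℤ}

theorem circlePoint_val (n : ℕ) (z : ℤ) : ((circlePoint n z).val : ℤ) = z % (2 * n + 1) := by
  have h1 := Int.emod_nonneg z (b := 2 * (n : ℤ) + 1) (by omega)
  simp only [circlePoint]
  omega

theorem circlePoint_eq_iff : circlePoint n z = circlePoint n w ↔ (2 * n + 1 : ℤ) ∣ w - z := by
  rw [Fin.ext_iff, ← Int.natCast_inj, circlePoint_val, circlePoint_val]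
  exact Int.modEq_iff_dvd

theorem circlePoint_coe (x : Fin (2 * n + 1)) : circlePoint n (x.val : ℤ) = x := by
  rw [Fin.ext_iff, ← Int.natCast_inj, circlePoint_val]
  exact Int.emod_eq_of_lt (by omega) (by omega)

theorem exists_eq_circlePoint (x : Fin (2 * n + 1)) :
    ∃ z : ℤ, 0 ≤ z ∧ z ≤ 2 * n ∧ x = circlePoint n z :=
  ⟨x.val, by omega, by omega, (circlePoint_coe x).symm⟩

theorem circlePoint_val_of_mem (h0 : 0 ≤ z) (h1 : z ≤ 2 * n) :
    ((circlePoint n z).val : ℤ) = z := by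
  rw [circlePoint_val]
  exact Int.emod_eq_of_lt h0 (by omega)

theorem circlePoint_congr (c : ℤ) (h : w - z = (2 * n + 1) * c) :
    circlePoint n z = circlePoint n w :=
  circlePoint_eq_iff.mpr ⟨c, h⟩

theorem eq_zero_of_dvd_of_lt {N t : ℤ} (h : N ∣ t) (h1 : -N < t) (h2 : t < N) : t = 0 :=
  Int.eq_zero_of_abs_lt_dvd h (abs_lt.mpr ⟨h1, h2⟩)

/-- The residue of a translated position, for translations by less than one turn. -/
theorem circlePoint_val_add {s : ℤ} (h1 : 0 ≤ s) (h2 : s < 2 * n + 1) :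
    ((circlePoint n (z + s)).val : ℤ) = (circlePoint n z).val + s ∨
    ((circlePoint n (z + s)).val : ℤ) = (circlePoint n z).val + s - (2 * n + 1) := by
  have hd : (2 * n + 1 : ℤ) ∣ ((circlePoint n (z + s)).val : ℤ) - ((circlePoint n z).val + s) := by
    rw [circlePoint_val, circlePoint_val]
    have e1 := Int.emod_add_mul_ediv z (2 * n + 1)
    have e2 := Int.emod_add_mul_ediv (z + s) (2 * n + 1)
    exact ⟨z / (2 * n + 1) - (z + s) / (2 * n + 1), by linear_combination e2 - e1⟩
  have b1 := (circlePoint n (z + s)).isLt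
  have b2 := (circlePoint n z).isLt
  rcases lt_or_ge (((circlePoint n z).val : ℤ) + s) (2 * n + 1) with h | h
  · left
    have := eq_zero_of_dvd_of_lt hd (by omega) (by omega)
    omega
  · right
    have := eq_zero_of_dvd_of_lt (t := ((circlePoint n (z + s)).val : ℤ) -
      ((circlePoint n z).val + s) + (2 * n + 1)) (dvd_add hd dvd_rfl) (by omega) (by omega)
    omega

theorem circlePoint_val_reflect (n : ℕ) (z : ℤ) :
    (circlePoint n (2 * n - z)).val + (circlePoint n z).val = 2 * n := by
  have hz := (circlePoint n z).isLt
  have hz' := (circlePoint n (2 * n - z)).isLt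
  have hd : (2 * n + 1 : ℤ) ∣
      ((circlePoint n (2 * n - z)).val : ℤ) - (2 * n - (circlePoint n z).val) := by
    rw [circlePoint_val, circlePoint_val]
    have e1 := Int.emod_add_mul_ediv z (2 * n + 1)
    have e2 := Int.emod_add_mul_ediv (2 * n - z) (2 * n + 1)
    exact ⟨-(z / (2 * n + 1)) - (2 * n - z) / (2 * n + 1), by linear_combination e2 + e1⟩
  have := eq_zero_of_dvd_of_lt hd (by omega) (by omega)
  omega

end CirclePoint

/-! ### Links as displacements -/

section Adjacency

variable {m n : ℕ}

theorem oddHarary_adj_iff {x y : Fin (2 * n + 1)} :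
    (oddHarary m n).Adj x y ↔ x ≠ y ∧ (circleDist x y ≤ m ∨ x.val + n = y.val ∨
      y.val + n = x.val) := by
  have h1 : (2 * m + 1) / 2 = m := by omega
  have h2 : (2 * n + 1) / 2 = n := by omega
  simp only [oddHarary, hararyGraph, h1, h2, vertexLabel]
  have h3 : Odd (2 * m + 1) := ⟨m, rfl⟩
  simp only [h3, true_and]
  constructor
  · rintro ⟨h, h' | h' | h'⟩
    · exact ⟨h, Or.inl h'⟩
    · exact ⟨h, Or.inr (Or.inl (by omega))⟩
    · exact ⟨h, Or.inr (Or.inr (by omega))⟩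
  · rintro ⟨h, h' | h' | h'⟩
    · exact ⟨h, Or.inl h'⟩
    · exact ⟨h, Or.inr (Or.inl (by omega))⟩
    · exact ⟨h, Or.inr (Or.inr (by omega))⟩

theorem circleDist_le_iff {x y : Fin (2 * n + 1)} (hmn : m ≤ n) :
    circleDist x y ≤ m ↔ ∃ s : ℤ, -m ≤ s ∧ s ≤ m ∧ ((y.val : ℤ) = x.val + s ∨
      (y.val : ℤ) = x.val + s + (2 * n + 1) ∨ (y.val : ℤ) = x.val + s - (2 * n + 1)) := by
  have hx := x.isLt
  have hy := y.isLt
  simp only [circleDist, vertexLabel, Nat.dist, min_le_iff]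
  constructor
  · intro h
    rcases h with h | h
    · exact ⟨y.val - x.val, by omega, by omega, Or.inl (by omega)⟩
    · rcases le_total x.val y.val with h' | h'
      · exact ⟨y.val - x.val - (2 * n + 1), by omega, by omega, Or.inr (Or.inl (by omega))⟩
      · exact ⟨y.val - x.val + (2 * n + 1), by omega, by omega, Or.inr (Or.inr (by omega))⟩
  · rintro ⟨s, h1, h2, h | h | h⟩ <;> omega

theorem oddHarary_adj_circle {s : ℤ} (hmn : m ≤ n) (z : ℤ) (h0 : 0 < s) (hs : s ≤ m) :
    (oddHarary m n).Adj (circlePoint n z) (circlePoint n (z + s)) := by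
  rw [oddHarary_adj_iff, circleDist_le_iff hmn]
  refine ⟨fun h => ?_, Or.inl ⟨s, by omega, hs, ?_⟩⟩
  · have := eq_zero_of_dvd_of_lt (circlePoint_eq_iff.mp h) (by omega) (by omega)
    omega
  · rcases circlePoint_val_add (n := n) (z := z) (s := s) (by omega) (by omega) with h | h
    · exact Or.inl h
    · exact Or.inr (Or.inr h)

theorem oddHarary_adj_chord (hn : 0 < n) (z : ℤ) (h : (circlePoint n z).val ≤ n) :
    (oddHarary m n).Adj (circlePoint n z) (circlePoint n (z + n)) := by
  have h1 := circlePoint_val_add (n := n) (z := z) (s := n) (by omega) (by omega)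
  have h2 : (circlePoint n z).val + n = (circlePoint n (z + n)).val := by
    have := (circlePoint n (z + n)).isLt
    omega
  rw [oddHarary_adj_iff]
  exact ⟨fun h' => by rw [← h'] at h2; omega, Or.inr (Or.inl h2)⟩

/-- From its upper end a long link goes back by `n`, that is, forward by `n + 1`. This discrepancy
of one position decides which pairs are affected by a deletion. -/
theorem oddHarary_adj_chord' (hn : 0 < n) (z : ℤ) (h : n ≤ (circlePoint n z).val) :
    (oddHarary m n).Adj (circlePoint n z) (circlePoint n (z + (n + 1))) := by
  have h1 := circlePoint_val_add (n := n) (z := z) (s := n + 1) (by omega) (by omega)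
  have h2 : (circlePoint n (z + (n + 1))).val + n = (circlePoint n z).val := by
    have := (circlePoint n (z + (n + 1))).isLt
    omega
  rw [oddHarary_adj_iff]
  exact ⟨fun h' => by rw [← h'] at h2; omega, Or.inr (Or.inr h2)⟩

/-- The links at a vertex, described by the displacements along the circle. -/
theorem oddHarary_adj_cases (hmn : m ≤ n) {z : ℤ} {y : Fin (2 * n + 1)}
    (h : (oddHarary m n).Adj (circlePoint n z) y) :
    ∃ s : ℤ, y = circlePoint n (z + s) ∧ s ≠ 0 ∧
      ((-m ≤ s ∧ s ≤ m) ∨ (s = n ∧ (circlePoint n z).val ≤ n) ∨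
        (s = n + 1 ∧ n ≤ (circlePoint n z).val)) := by
  have hz := (circlePoint n z).isLt
  have hy := y.isLt
  have hcong : ∀ c s : ℤ, (y.val : ℤ) = (circlePoint n z).val + s + (2 * n + 1) * c →
      y = circlePoint n (z + s) := by
    intro c s hs
    rw [← circlePoint_coe y]
    have e1 := Int.emod_add_mul_ediv z (2 * n + 1)
    rw [circlePoint_val] at hs
    refine circlePoint_congr (z / (2 * n + 1) - c) ?_
    linear_combination -hs - e1
  obtain ⟨hne, h⟩ := oddHarary_adj_iff.mp h
  rcases h with h | h | h
  · obtain ⟨s, h1, h2, h3⟩ := (circleDist_le_iff hmn).mp h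
    refine ⟨s, ?_, ?_, Or.inl ⟨h1, h2⟩⟩
    · rcases h3 with h3 | h3 | h3
      · exact hcong 0 s (by omega)
      · exact hcong 1 s (by omega)
      · exact hcong (-1) s (by omega)
    · rintro rfl
      apply hne
      rw [Fin.ext_iff]
      omega
  · exact ⟨n, hcong 0 n (by omega), by omega, Or.inr (Or.inl ⟨rfl, by omega⟩)⟩
  · exact ⟨n + 1, hcong (-1) (n + 1) (by omega), by omega, Or.inr (Or.inr ⟨rfl, by omega⟩)⟩

/-- The reflection of the circle that fixes the vertex with two long links. -/
theorem oddHarary_adj_reflect (hmn : m ≤ n) {z w : ℤ}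
    (h : (oddHarary m n).Adj (circlePoint n z) (circlePoint n w)) :
    (oddHarary m n).Adj (circlePoint n (2 * n - z)) (circlePoint n (2 * n - w)) := by
  have h1 := circlePoint_val_reflect n z
  have h2 := circlePoint_val_reflect n w
  rw [oddHarary_adj_iff, circleDist_le_iff hmn] at h ⊢
  obtain ⟨hne, h⟩ := h
  refine ⟨fun h' => hne ?_, ?_⟩
  · rw [Fin.ext_iff] at h' ⊢
    omega
  · rcases h with ⟨s, h3, h4, h⟩ | h | h
    · exact Or.inl ⟨-s, by omega, by omega, by omega⟩
    · exact Or.inr (Or.inr (by omega))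
    · exact Or.inr (Or.inl (by omega))

end Adjacency

/-! ### Deleted links and the range of `p` -/

/-- The Harary graph `H_{2m+1,2n+1}` without the link between the positions `u` and `v`. -/
abbrev cutHarary (m n : ℕ) (u v : ℤ) : SimpleGraph (Fin (2 * n + 1)) :=
  (oddHarary m n).deleteEdges {s(circlePoint n u, circlePoint n v)}

/-- The inequalities that say `p = ⌊(n + m - 1) / (2 * m)⌋`, for `m > 2` and `p > 1`. -/
structure HararyRange (m n p : ℕ) : Prop where
  two_lt : 2 < m
  two_le : 2 ≤ p
  lower : 2 * (p * m) + 1 ≤ n + m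
  upper : n ≤ 2 * (p * m) + m

/-- `omega` treats `p * m` as an atom, so bounds on factors have to be supplied in multiplied form;
the next two lemmas serve the same purpose. -/
theorem HararyRange.le_mul {m n p : ℕ} (h : HararyRange m n p) : 2 * (m : ℤ) ≤ (p : ℤ) * m := by
  exact_mod_cast Nat.mul_le_mul_right m h.two_le

theorem natCast_mul_le {a p : ℕ} (m : ℕ) (h : a ≤ p) : (a : ℤ) * m ≤ (p : ℤ) * m := by
  exact_mod_cast Nat.mul_le_mul_right m h

theorem natCast_succ_mul (a m : ℕ) : ((a + 1 : ℕ) : ℤ) * m = a * m + m := by push_cast; ring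

/-! ### Balls and diameter -/

section Ball

variable {m n : ℕ}

/-- The ball of radius `k` lies in the union of an arc around its centre and an arc around the
antipodal points. -/
theorem oddHarary_within_subset (hm : 2 < m) (hmn : m ≤ n) (z : ℤ) (k : ℕ) (y : Fin (2 * n + 1))
    (h : (oddHarary m n).Within k (circlePoint n z) y) :
    ∃ s : ℤ, y = circlePoint n (z + s) ∧ ((-(k * m : ℤ) ≤ s ∧ s ≤ k * m) ∨
      (1 ≤ k ∧ (n : ℤ) + m - k * m ≤ s ∧ s ≤ n + 1 + k * m - m)) := by
  revert k y h
  refine SimpleGraph.Within.rec_snoc ⟨0, by simp⟩ ?_ ?_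
  · rintro k y ⟨s, rfl, h⟩
    refine ⟨s, rfl, ?_⟩
    rw [natCast_succ_mul]
    omega
  · rintro k y y' ⟨s, rfl, h⟩ hadj
    obtain ⟨d, rfl, -, hd⟩ := oddHarary_adj_cases hmn hadj
    rw [natCast_succ_mul]
    have hk : (0 : ℤ) ≤ k * m := by positivity
    rcases h with h | h
    · exact ⟨s + d, by rw [add_assoc], by omega⟩
    -- A second long link undoes the first up to one position, so it leads back into the near arc.
    · rcases hd with hd | hd | hd
      · exact ⟨s + d, by rw [add_assoc], by omega⟩
      · exact ⟨s + d - (2 * n + 1), circlePoint_congr (-1) (by ring), by omega⟩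
      · exact ⟨s + d - (2 * n + 1), circlePoint_congr (-1) (by ring), by omega⟩

/-- In a graph with all the short circle links, positions at most `k * m` apart are within `k`. -/
theorem within_circle {H : SimpleGraph (Fin (2 * n + 1))}
    (hH : ∀ z s : ℤ, 0 < s → s ≤ m → H.Adj (circlePoint n z) (circlePoint n (z + s)))
    (k : ℕ) (z s : ℤ) (h0 : 0 ≤ s) (hs : s ≤ k * m) :
    H.Within k (circlePoint n z) (circlePoint n (z + s)) := by
  induction k generalizing z s with
  | zero =>
    obtain rfl : s = 0 := by simp at hs; omega
    rw [add_zero]; exact SimpleGraph.Within.refl _ _ _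
  | succ k ih =>
    rw [natCast_succ_mul] at hs
    rcases lt_trichotomy s 0 with h | h | h
    · omega
    · subst h; rw [add_zero]; exact SimpleGraph.Within.refl _ _ _
    · rcases le_or_gt s m with h' | h'
      · exact (SimpleGraph.Within.of_adj (hH z s h h')).mono (by omega)
      · have h2 := ih (z + m) (s - m) (by omega) (by omega)
        rw [show z + m + (s - m) = z + s by ring] at h2
        by_cases hm0 : m = 0
        · subst hm0
          simp at hs; omega
        · exact ((SimpleGraph.Within.of_adj (hH z m (by omega) le_rfl)).trans h2).mono (by omega)

theorem within_circle_of_abs {H : SimpleGraph (Fin (2 * n + 1))}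
    (hH : ∀ z s : ℤ, 0 < s → s ≤ m → H.Adj (circlePoint n z) (circlePoint n (z + s)))
    (k : ℕ) (z w : ℤ) (h1 : z ≤ w + k * m) (h2 : w ≤ z + k * m) :
    H.Within k (circlePoint n z) (circlePoint n w) := by
  rcases le_total z w with h | h
  · have := within_circle hH k z (w - z) (by omega) (by omega)
    rwa [add_sub_cancel] at this
  · have := within_circle hH k w (z - w) (by omega) (by omega)
    rw [add_sub_cancel] at this
    exact this.symm

/-- The diameter of the Harary graph is at most `p + 1`. -/
theorem oddHarary_within_diam {p : ℕ} (hR : HararyRange m n p) (x y : Fin (2 * n + 1)) :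
    (oddHarary m n).Within (p + 1) x y := by
  have h1 := hR.two_lt
  have h3 := hR.lower
  have h4 := hR.upper
  have h5 := hR.le_mul
  zify at h3 h4
  have hmn : m ≤ n := by omega
  have key : ∀ z s : ℤ, 0 ≤ s → s ≤ n →
      (oddHarary m n).Within (p + 1) (circlePoint n z) (circlePoint n (z + s)) := by
    intro z s h0 hs
    rcases le_or_gt s (p * m + m) with h | h
    · exact within_circle (fun z s => oddHarary_adj_circle hmn z) _ _ _ h0
        (by rw [natCast_succ_mul]; exact h)
    -- The long link at `z` lands at `z + n` or `z + n + 1`; since `s > pm + m` and `n ≤ 2pm + m`,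
    -- at most `p` short steps lead back to `z + s`.
    · rcases le_or_gt (circlePoint n z).val n with hz | hz
      · refine ((SimpleGraph.Within.of_adj (oddHarary_adj_chord (by omega) z hz)).trans
          (within_circle_of_abs (fun z s => oddHarary_adj_circle hmn z) p _ _ ?_ ?_)).mono
          (by omega) <;> omega
      · refine ((SimpleGraph.Within.of_adj (oddHarary_adj_chord' (by omega) z hz.le)).trans
          (within_circle_of_abs (fun z s => oddHarary_adj_circle hmn z) p _ _ ?_ ?_)).mono
          (by omega) <;> omega
  obtain ⟨z, hz0, hz1, rfl⟩ := exists_eq_circlePoint x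
  obtain ⟨w, hw0, hw1, rfl⟩ := exists_eq_circlePoint y
  rcases le_or_gt 0 (w - z) with h | h
  · rcases le_or_gt (w - z) n with h' | h'
    · have := key z (w - z) h h'
      rwa [add_sub_cancel] at this
    · have := (key w (z - w + (2 * n + 1)) (by omega) (by omega)).symm
      rwa [circlePoint_congr (w := z) (z := w + (z - w + (2 * n + 1))) (-1) (by ring)] at this
  · rcases le_or_gt (z - w) n with h' | h'
    · have := (key w (z - w) (by omega) h').symm
      rwa [add_sub_cancel] at this
    · have := key z (w - z + (2 * n + 1)) (by omega) (by omega)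
      rwa [circlePoint_congr (w := w) (z := z + (w - z + (2 * n + 1))) (-1) (by ring)] at this

end Ball

/-! ### Deleting a link, and the reflection symmetry -/

section Cut

variable {m n : ℕ} {u v z w r s : ℤ}

theorem cutHarary_adj_of (h : (oddHarary m n).Adj (circlePoint n z) (circlePoint n w))
    (h1 : ¬ ((2 * n + 1 : ℤ) ∣ u - z ∧ (2 * n + 1 : ℤ) ∣ v - w))
    (h2 : ¬ ((2 * n + 1 : ℤ) ∣ v - z ∧ (2 * n + 1 : ℤ) ∣ u - w)) :
    (cutHarary m n u v).Adj (circlePoint n z) (circlePoint n w) := by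
  rw [SimpleGraph.deleteEdges_adj]
  refine ⟨h, fun h' => ?_⟩
  rcases Sym2.eq_iff.mp (Set.mem_singleton_iff.mp h') with ⟨ha, hb⟩ | ⟨ha, hb⟩
  · exact h1 ⟨circlePoint_eq_iff.mp ha, circlePoint_eq_iff.mp hb⟩
  · exact h2 ⟨circlePoint_eq_iff.mp ha, circlePoint_eq_iff.mp hb⟩

/-- The automorphism `z ↦ 2n - z` exchanges the two sides of a link, so statements about its far end
follow from those about its near end. -/
theorem cutHarary_within_reflect (hmn : m ≤ n) {k : ℕ}
    (h : (cutHarary m n u v).Within k (circlePoint n z) (circlePoint n w)) :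
    (cutHarary m n (2 * n - v) (2 * n - u)).Within k
      (circlePoint n (2 * n - z)) (circlePoint n (2 * n - w)) := by
  have key : ∀ (k : ℕ) (y : Fin (2 * n + 1)), (cutHarary m n u v).Within k (circlePoint n z) y →
      ∀ w, y = circlePoint n w → (cutHarary m n (2 * n - v) (2 * n - u)).Within k
      (circlePoint n (2 * n - z)) (circlePoint n (2 * n - w)) := by
    have hc : ∀ a b : ℤ, circlePoint n a = circlePoint n b →
        circlePoint n (2 * n - a) = circlePoint n (2 * n - b) := by
      intro a b hab
      rw [circlePoint_eq_iff] at hab ⊢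
      obtain ⟨c, hc⟩ := hab
      exact ⟨-c, by linear_combination -hc⟩
    refine SimpleGraph.Within.rec_snoc ?_ ?_ ?_
    · intro w hw
      rw [hc _ _ hw]; exact SimpleGraph.Within.refl _ _ _
    · exact fun k y ih w hw => (ih w hw).mono (by omega)
    · rintro k y y' ih hadj w rfl
      obtain ⟨t, -, -, rfl⟩ := exists_eq_circlePoint y
      refine (ih t rfl).trans (SimpleGraph.Within.of_adj ?_)
      rw [SimpleGraph.deleteEdges_adj] at hadj
      have hdvd : ∀ a b : ℤ, (2 * n + 1 : ℤ) ∣ 2 * n - a - (2 * n - b) →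
          (2 * n + 1 : ℤ) ∣ a - b := by
        rintro a b ⟨c, hc⟩
        exact ⟨-c, by linear_combination -hc⟩
      refine cutHarary_adj_of (oddHarary_adj_reflect hmn hadj.1) ?_ ?_
      · rintro ⟨h1, h2⟩
        refine hadj.2 (Set.mem_singleton_iff.mpr (Sym2.eq_iff.mpr (Or.inr ⟨?_, ?_⟩)))
        · exact circlePoint_eq_iff.mpr (hdvd _ _ h1)
        · exact circlePoint_eq_iff.mpr (hdvd _ _ h2)
      · rintro ⟨h1, h2⟩
        refine hadj.2 (Set.mem_singleton_iff.mpr (Sym2.eq_iff.mpr (Or.inl ⟨?_, ?_⟩)))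
        · exact circlePoint_eq_iff.mpr (hdvd _ _ h1)
        · exact circlePoint_eq_iff.mpr (hdvd _ _ h2)
  exact key k _ h w rfl

end Cut

/-! ### Pairs that need a short link -/

section ShortCut

variable {m n : ℕ} {u z r s : ℤ}

theorem not_dvd_of_mem {N t : ℤ} (h0 : 0 < t) (h1 : t < N) : ¬ N ∣ t := fun h => by
  have := eq_zero_of_dvd_of_lt h (by omega) h1
  omega

theorem not_dvd_of_neg_mem {N t : ℤ} (h0 : t < 0) (h1 : -N < t) : ¬ N ∣ t := fun h => by
  have := eq_zero_of_dvd_of_lt h h1 (by omega)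
  omega

theorem cutHarary_adj_circle (hmn : m ≤ n) (hr0 : 0 < r) (hr : r ≤ m) (h0 : 0 < s)
    (hs : s ≤ m) (h : ¬ ((2 * n + 1 : ℤ) ∣ u - z ∧ s = r)) :
    (cutHarary m n u (u + r)).Adj (circlePoint n z) (circlePoint n (z + s)) := by
  refine cutHarary_adj_of (oddHarary_adj_circle hmn z h0 hs) ?_ ?_
  · rintro ⟨h1, h2⟩
    refine h ⟨h1, ?_⟩
    have h3 : (2 * n + 1 : ℤ) ∣ r - s := by
      have := dvd_sub h2 h1
      rwa [show u + r - (z + s) - (u - z) = r - s by ring] at this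
    have := eq_zero_of_dvd_of_lt h3 (by omega) (by omega)
    omega
  · rintro ⟨h1, h2⟩
    have h3 : (2 * n + 1 : ℤ) ∣ r + s := by
      have := dvd_sub h1 h2
      rwa [show u + r - z - (u - (z + s)) = r + s by ring] at this
    exact not_dvd_of_mem (by omega) (by omega) h3

theorem cutHarary_adj_chord (hmn : m < n) (hr0 : 0 < r) (hr : r ≤ m)
    (h : (circlePoint n z).val ≤ n) :
    (cutHarary m n u (u + r)).Adj (circlePoint n z) (circlePoint n (z + n)) := by
  refine cutHarary_adj_of (oddHarary_adj_chord (by omega) z h) ?_ ?_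
  · rintro ⟨h1, h2⟩
    have := dvd_sub h2 h1
    rw [show u + r - (z + n) - (u - z) = r - n by ring] at this
    exact not_dvd_of_neg_mem (by omega) (by omega) this
  · rintro ⟨h1, h2⟩
    have := dvd_sub h1 h2
    rw [show u + r - z - (u - (z + n)) = r + n by ring] at this
    exact not_dvd_of_mem (by omega) (by omega) this

theorem cutHarary_adj_chord' (hmn : m < n) (hr0 : 0 < r) (hr : r ≤ m)
    (h : n ≤ (circlePoint n z).val) :
    (cutHarary m n u (u + r)).Adj (circlePoint n z) (circlePoint n (z + (n + 1))) := by
  refine cutHarary_adj_of (oddHarary_adj_chord' (by omega) z h) ?_ ?_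
  · rintro ⟨h1, h2⟩
    have := dvd_sub h2 h1
    rw [show u + r - (z + (n + 1)) - (u - z) = r - (n + 1) by ring] at this
    exact not_dvd_of_neg_mem (by omega) (by omega) this
  · rintro ⟨h1, h2⟩
    have := dvd_sub h1 h2
    rw [show u + r - z - (u - (z + (n + 1))) = r + (n + 1) by ring] at this
    exact not_dvd_of_mem (by omega) (by omega) this

/-- Going around the circle without using a given short link. This costs nothing, unless all the
steps have to be of length `m` and the given link is one of them. -/
theorem cutHarary_within_circle (hm : 2 < m) (hmn : m < n) (hr0 : 0 < r) (hr : r ≤ m) (k : ℕ)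
    (z s : ℤ) (h0 : 0 ≤ s) (hs : s ≤ k * m) (hk : (k * m : ℤ) ≤ 2 * n)
    (hA : r = m → s = k * m → ∀ j : ℕ, j < k → ¬ (2 * n + 1 : ℤ) ∣ z + j * m - u)
    (hB : k = 1 → s = r → ¬ (2 * n + 1 : ℤ) ∣ u - z) :
    (cutHarary m n u (u + r)).Within k (circlePoint n z) (circlePoint n (z + s)) := by
  induction k generalizing z s with
  | zero =>
    obtain rfl : s = 0 := by simp at hs; omega
    rw [add_zero]; exact SimpleGraph.Within.refl _ _ _
  | succ k ih =>
    rw [natCast_succ_mul] at hs hk hA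
    rcases h0.eq_or_lt with rfl | hpos
    · rw [add_zero]; exact SimpleGraph.Within.refl _ _ _
    have step : ∀ z s : ℤ, 0 < s → s ≤ m → ¬ ((2 * n + 1 : ℤ) ∣ u - z ∧ s = r) →
        (cutHarary m n u (u + r)).Within 1 (circlePoint n z) (circlePoint n (z + s)) :=
      fun z s h0 h1 h2 => SimpleGraph.Within.of_adj (cutHarary_adj_circle hmn.le hr0 hr h0 h1 h2)
    have shift : ∀ {z t : ℤ}, (2 * n + 1 : ℤ) ∣ u - z → (2 * n + 1 : ℤ) ∣ u - (z + t) →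
        (2 * n + 1 : ℤ) ∣ t := by
      intro z t h1 h2
      have := dvd_sub h1 h2
      rwa [show u - z - (u - (z + t)) = t by ring] at this
    rcases Nat.eq_zero_or_pos k with rfl | hk1
    · refine step z s hpos (by simpa using hs) ?_
      rintro ⟨h1, rfl⟩
      exact hB rfl rfl h1
    have hmk : (m : ℤ) ≤ k * m := by
      have := natCast_mul_le m hk1
      simpa using this
    rcases le_or_gt s m with hsm | hsm
    · by_cases hbad : (2 * n + 1 : ℤ) ∣ u - z ∧ s = r
      · obtain ⟨hd, rfl⟩ := hbad
        -- A deleted link of length 1 is bypassed by overshooting: two forward, one back. A longer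
        -- one is split into two steps.
        rcases (show s = 1 ∨ 1 < s by omega) with rfl | hs1
        · have h1 := step z 2 (by omega) (by omega) (by omega)
          have h2 := step (z + 1) 1 (by omega) (by omega) fun h =>
            not_dvd_of_mem (by omega) (by omega) (shift hd h.1)
          rw [show z + 1 + 1 = z + 2 by ring] at h2
          exact (h1.trans h2.symm).mono (by omega)
        · have h1 := step z 1 (by omega) (by omega) (by omega)
          have h2 := step (z + 1) (s - 1) (by omega) (by omega) (by omega)
          rw [show z + 1 + (s - 1) = z + s by ring] at h2
          exact (h1.trans h2).mono (by omega)
      · exact (step z s hpos hsm hbad).mono (by omega)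
    · by_cases hbad : (2 * n + 1 : ℤ) ∣ u - z ∧ (m : ℤ) = r
      · obtain ⟨hd, rfl⟩ := hbad
        -- The first step of length `m` would be the deleted link. By `hA` the walk has slack, so a
        -- first step of length `m - 1` is affordable.
        have hne : s ≠ k * m + m := by
          intro h
          refine hA rfl h 0 (by omega) ?_
          have := (dvd_neg (a := (2 * n + 1 : ℤ))).mpr hd
          simpa using this
        have h1 := step z (m - 1) (by omega) (by omega) (by omega)
        have h2 := ih (z + (m - 1)) (s - (m - 1)) (by omega) (by omega) (by omega) ?_ ?_
        · rw [show z + ((m : ℤ) - 1) + (s - (m - 1)) = z + s by ring] at h2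
          exact (h1.trans h2).mono (by omega)
        · intro _ h3 j hj h4
          have hj' := natCast_mul_le m (show j + 1 ≤ k by omega)
          rw [natCast_succ_mul] at hj'
          have hj0 : (0 : ℤ) ≤ j * m := by positivity
          have h5 := dvd_add h4 hd
          rw [show z + ((m : ℤ) - 1) + j * m - u + (u - z) = j * m + m - 1 by ring] at h5
          exact not_dvd_of_mem (by omega) (by omega) h5
        · intro _ _ h4
          exact not_dvd_of_mem (by omega) (by omega) (shift hd h4)
      -- The remaining obstruction is a last single step equal to the deleted link; for `r < m`
      -- exchanging the two steps avoids it.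
      · by_cases hend : k = 1 ∧ s - m = r ∧ (2 * n + 1 : ℤ) ∣ u - (z + m)
        · obtain ⟨rfl, hsr, hd⟩ := hend
          by_cases hrm : r = m
          · exfalso
            refine hA hrm (by simp; omega) 1 (by omega) ?_
            have := (dvd_neg (a := (2 * n + 1 : ℤ))).mpr hd
            rw [show -(u - (z + m)) = z + ((1 : ℕ) : ℤ) * m - u by push_cast; ring] at this
            exact this
          · have h1 := step z r (by omega) (by omega) fun h =>
              not_dvd_of_mem (by omega) (by omega) (shift h.1 hd)
            have h2 := step (z + r) m (by omega) (by omega) (by omega)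
            rw [show z + r + m = z + s by omega] at h2
            exact h1.trans h2
        · have h1 := step z m (by omega) le_rfl hbad
          have h2 := ih (z + m) (s - m) (by omega) (by omega) (by omega) ?_ ?_
          · rw [show z + (m : ℤ) + (s - m) = z + s by ring] at h2
            exact (h1.trans h2).mono (by omega)
          · intro h3 h4 j hj h5
            refine hA h3 (by omega) (j + 1) (by omega) ?_
            rw [natCast_succ_mul]
            rwa [show z + (j * m + m : ℤ) - u = z + m + j * m - u by ring]
          · intro h3 h4 h5
            exact hend ⟨h3, h4, h5⟩

end ShortCut

section ShortCut

variable {m n p : ℕ} {u z r s : ℤ}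

/-- Strict inequalities rule out walks with all steps of length `m`, and `2 ≤ k` rules out the link
as the only step, so both exceptions of `cutHarary_within_circle` are void. -/
theorem cutHarary_within_of_lt (hm : 2 < m) (hmn : m < n) (hr0 : 0 < r) (hr : r ≤ m) {k : ℕ}
    (hk : 2 ≤ k) (hkn : (k * m : ℤ) ≤ 2 * n) {z w : ℤ} (h1 : z < w + k * m)
    (h2 : w < z + k * m) :
    (cutHarary m n u (u + r)).Within k (circlePoint n z) (circlePoint n w) := by
  rcases le_total z w with h | h
  · have := cutHarary_within_circle (u := u) hm hmn hr0 hr k z (w - z) (by omega) (by omega) hkn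
      (by omega) (by omega)
    rwa [add_sub_cancel] at this
  · have := cutHarary_within_circle (u := u) hm hmn hr0 hr k w (z - w) (by omega) (by omega) hkn
      (by omega) (by omega)
    rw [add_sub_cancel] at this
    exact this.symm

/-- The vertices from which the link `(u, u + r)` is needed to reach `u + r`. -/
theorem cutHarary_near_end (hR : HararyRange m n p) (hr0 : 0 < r) (hr : r ≤ m) {a : ℕ}
    (ha : a ≤ p) {x : Fin (2 * n + 1)}
    (h1 : (cutHarary m n u (u + r)).Within a x (circlePoint n u))
    (h2 : ¬ (cutHarary m n u (u + r)).Within (a + 1) x (circlePoint n (u + r))) :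
    (x = circlePoint n (u - a * m) ∧ (a = 0 ∨ r = m)) ∨
    (r = m ∧ 1 ≤ a ∧ x = circlePoint n (u + n + m - a * m) ∧
      n < (circlePoint n (u + r)).val) := by
  have b1 := hR.two_lt
  have b3 := hR.lower
  have b5 := hR.le_mul
  zify at b3
  have hmn : m < n := by omega
  have ham := natCast_mul_le m ha
  have ham0 : (0 : ℤ) ≤ a * m := by positivity
  obtain ⟨s, rfl, hs⟩ := oddHarary_within_subset b1 hmn.le u a x
    (h1.symm.mono_graph (SimpleGraph.deleteEdges_le _))
  rcases Nat.eq_zero_or_pos a with rfl | ha1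
  · left
    refine ⟨?_, Or.inl rfl⟩
    rcases hs with hs | hs
    · simp at hs
      have : s = 0 := by omega
      simp [this]
    · omega
  have hma : (m : ℤ) ≤ a * m := by simpa using natCast_mul_le m ha1
  rcases hs with hs | ⟨-, hs⟩
  · by_cases hend : s = -(a * m) ∧ r = m
    · left
      rw [hend.1]
      exact ⟨by rw [sub_eq_add_neg], Or.inr hend.2⟩
    · refine absurd (cutHarary_within_of_lt b1 hmn hr0 hr (by omega) ?_ ?_ ?_) h2 <;>
        rw [natCast_succ_mul] <;> omega
  · have hfar : ∀ j : ℕ, j < a → ¬ (2 * n + 1 : ℤ) ∣ u + s + j * m - u := by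
      intro j hj hd
      have hj' := natCast_mul_le m (show j + 1 ≤ a by omega)
      rw [natCast_succ_mul] at hj'
      have hj0 : (0 : ℤ) ≤ j * m := by positivity
      exact not_dvd_of_mem (by omega) (by omega) hd
    have hfar' : ¬ (2 * n + 1 : ℤ) ∣ u - (u + s) :=
      not_dvd_of_neg_mem (by omega) (by omega)
    have hgo : ∀ w : ℤ, w - (u + s) ≤ a * m → -(a * m : ℤ) < w - (u + s) →
        (a = 1 → u + s - w ≠ r) →
        (cutHarary m n u (u + r)).Within a (circlePoint n (u + s)) (circlePoint n w) := by
      intro w hw1 hw2 hw3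
      rcases le_total 0 (w - (u + s)) with h | h
      · have := cutHarary_within_circle (u := u) b1 hmn hr0 hr a (u + s) (w - (u + s)) h hw1
          (by omega) (fun _ _ => hfar) (fun _ _ => hfar')
        rwa [add_sub_cancel] at this
      · have := cutHarary_within_circle (u := u) b1 hmn hr0 hr a w (u + s - w) (by omega)
          (by omega) (by omega) (by omega) (fun h4 h5 => absurd h5 (hw3 h4))
        rw [add_sub_cancel] at this
        exact this.symm
    have hone : a = 1 → (a * m : ℤ) = m := by rintro rfl; simp
    -- The far arc is reached through the long link at `u + r`. Landing at `u + r + n` is always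
    -- close enough; landing one position further misses only the extreme point, and only for `r =
    -- m`.
    rcases le_or_gt (circlePoint n (u + r)).val n with hv | hv
    · exfalso
      have hadj := cutHarary_adj_chord (m := m) (u := u) (z := u + r) hmn hr0 hr hv
      exact h2 ((hgo _ (by omega) (by omega) (by omega)).trans
        (SimpleGraph.Within.of_adj hadj.symm))
    · by_cases hend : r = m ∧ s = n + m - a * m
      · right
        refine ⟨hend.1, ha1, ?_, hv⟩
        rw [hend.2]
        congr 1; ring
      · exfalso
        have hadj := cutHarary_adj_chord' (m := m) (u := u) (z := u + r) hmn hr0 hr hv.le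
        exact h2 ((hgo _ (by omega) (by omega) (by omega)).trans
          (SimpleGraph.Within.of_adj hadj.symm))

theorem circlePoint_reflect_inj {z w : ℤ}
    (h : circlePoint n (2 * n - z) = circlePoint n (2 * n - w)) :
    circlePoint n z = circlePoint n w := by
  have h1 := circlePoint_val_reflect n z
  have h2 := circlePoint_val_reflect n w
  rw [Fin.ext_iff] at h ⊢
  omega

/-- The vertices that need the link `(u, u + r)` to be reached from `u`. -/
theorem cutHarary_far_end (hR : HararyRange m n p) (hr0 : 0 < r) (hr : r ≤ m) {b : ℕ}
    (hb : b ≤ p) {y : Fin (2 * n + 1)}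
    (h1 : (cutHarary m n u (u + r)).Within b (circlePoint n (u + r)) y)
    (h2 : ¬ (cutHarary m n u (u + r)).Within (b + 1) (circlePoint n u) y) :
    (y = circlePoint n (u + r + b * m) ∧ (b = 0 ∨ r = m)) ∨
    (r = m ∧ 1 ≤ b ∧ y = circlePoint n (u - n + b * m) ∧ (circlePoint n u).val < n) := by
  have b1 := hR.two_lt
  have b3 := hR.lower
  have b5 := hR.le_mul
  zify at b3
  have hmn : m ≤ n := by omega
  obtain ⟨w, -, -, rfl⟩ := exists_eq_circlePoint y
  have e1 : ∀ z : ℤ, 2 * (n : ℤ) - (2 * n - z) = z := fun z => by ring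
  have e2 : 2 * (n : ℤ) - (u + r) + r = 2 * n - u := by ring
  have h1' := cutHarary_within_reflect hmn h1
  have h2' : ¬ (cutHarary m n (2 * n - (u + r)) (2 * n - u)).Within (b + 1)
      (circlePoint n (2 * n - u)) (circlePoint n (2 * n - w)) := fun h => by
    have := cutHarary_within_reflect hmn h
    simp only [e1] at this
    exact h2 this
  have key := cutHarary_near_end (u := 2 * n - (u + r)) hR hr0 hr hb
    (by rw [e2]; exact h1'.symm) (by rw [e2]; exact fun h => h2' h.symm)
  rw [e2] at key
  rcases key with ⟨h, hbr⟩ | ⟨hrm, hb1, h, hv⟩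
  · refine Or.inl ⟨?_, hbr⟩
    apply circlePoint_reflect_inj
    rw [h]; congr 1; ring
  · refine Or.inr ⟨hrm, hb1, ?_, ?_⟩
    · apply circlePoint_reflect_inj
      rw [h]; congr 1; rw [hrm]; ring
    · have := circlePoint_val_reflect n u
      omega

/-- Links shorter than `m` are only needed between their own ends; links of length `m` are needed
by pairs on the circle and by pairs whose shortest walks use one long link. -/
theorem cutHarary_affected (hR : HararyRange m n p) (hu0 : 0 ≤ u) (hu1 : u ≤ 2 * n) (hr0 : 0 < r)
    (hr : r ≤ m) {a b : ℕ} (hab : a + b ≤ p) {x y : Fin (2 * n + 1)}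
    (hmin : ∀ j < a + b + 1, ¬ (oddHarary m n).Within j x y)
    (hn : ¬ (cutHarary m n u (u + r)).Within (a + b + 1) x y)
    (h1 : (cutHarary m n u (u + r)).Within a x (circlePoint n u))
    (h2 : ¬ (cutHarary m n u (u + r)).Within (a + 1) x (circlePoint n (u + r)))
    (h3 : (cutHarary m n u (u + r)).Within b (circlePoint n (u + r)) y)
    (h4 : ¬ (cutHarary m n u (u + r)).Within (b + 1) (circlePoint n u) y) :
    (x = circlePoint n (u - a * m) ∧ y = circlePoint n (u + r + b * m) ∧
      (a + b = p → (n < (circlePoint n (u + r)).val → 1 ≤ b) ∧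
        ((circlePoint n u).val < n → 1 ≤ a) ∧
        ¬ ((circlePoint n u).val < n ∧ n < (circlePoint n (u + r)).val))) ∨
    (a + b < p ∧ 1 ≤ a ∧ n < (circlePoint n (u + r)).val ∧
      x = circlePoint n (u + n + m - a * m) ∧ y = circlePoint n (u + r + b * m)) ∨
    (a + b < p ∧ 1 ≤ b ∧ (circlePoint n u).val < n ∧
      x = circlePoint n (u - a * m) ∧ y = circlePoint n (u - n + b * m)) := by
  have b1 := hR.two_lt
  have b2 := hR.two_le
  have b3 := hR.lower
  have b4 := hR.upper
  have b5 := hR.le_mul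
  zify at b3 b4
  have hmn : m < n := by omega
  have ha0 : (0 : ℤ) ≤ a * m := by positivity
  have hb0 : (0 : ℤ) ≤ b * m := by positivity
  have habm : (a * m + b * m : ℤ) ≤ p * m := by
    have := natCast_mul_le m hab
    push_cast at this
    linarith
  rcases cutHarary_near_end hR hr0 hr (by omega) h1 h2 with ⟨hx, har⟩ | ⟨rfl, ha1, hx, hv⟩
  · rcases cutHarary_far_end hR hr0 hr (by omega) h3 h4 with ⟨hy, hbr⟩ | ⟨rfl, hb1, hy, hu⟩
    · left
      refine ⟨hx, hy, fun hp => ?_⟩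
      have hrm : r = m := by omega
      subst hrm
      have habm' : (a * m + b * m : ℤ) = p * m := by
        rw [← hp]; push_cast; ring
      have hjm : ∀ j : ℕ, j < p → (0 : ℤ) ≤ j * m ∧ (j * m + m : ℤ) ≤ p * m := by
        intro j hj
        have := natCast_mul_le m (show j + 1 ≤ p by omega)
        rw [natCast_succ_mul] at this
        exact ⟨by positivity, this⟩
      -- Otherwise `x` has a long link to `x + n`, which is `n - pm - m ≤ pm` beyond `y`: a walk of
      -- length `p + 1` avoids the deleted link. The next claim treats `y` in the same way.
      have hxv : n < (circlePoint n (u - a * m)).val := by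
        by_contra hle
        have hadj := cutHarary_adj_chord (m := m) (u := u) (z := u - a * m) hmn hr0 hr
          (not_lt.mp hle)
        have hw := cutHarary_within_circle (u := u) b1 hmn hr0 hr p (u + m + b * m)
          (n - p * m - m) (by omega) (by omega) (by omega) ?_ (by omega)
        · rw [show u + m + b * m + (n - p * m - m) = u - a * m + n by omega] at hw
          refine hn ?_
          rw [hx, hy, hp]
          exact ((SimpleGraph.Within.of_adj hadj).trans hw.symm).mono (by omega)
        · intro _ h6 j hj
          have := hjm j hj
          exact not_dvd_of_mem (by omega) (by omega)
      have hyv : (circlePoint n (u + m + b * m)).val < n := by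
        by_contra hle
        have hadj := cutHarary_adj_chord' (m := m) (u := u) (z := u + m + b * m) hmn hr0 hr
          (not_lt.mp hle)
        have hw := cutHarary_within_circle (u := u) b1 hmn hr0 hr p (u + m + b * m - n)
          (n - p * m - m) (by omega) (by omega) (by omega) ?_ (by omega)
        · rw [show u + m + b * m - n + (n - p * m - m) = u - a * m by omega,
            circlePoint_congr (z := u + m + b * m - n) (w := u + m + b * m + (n + 1)) 1
              (by ring)] at hw
          refine hn ?_
          rw [hx, hy, hp]
          exact hw.symm.trans (SimpleGraph.Within.of_adj hadj.symm)
        · intro _ h6 j hj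
          have := hjm j hj
          exact not_dvd_of_neg_mem (by omega) (by omega)
      refine ⟨fun h => ?_, fun h => ?_, fun ⟨h, h'⟩ => ?_⟩
      · by_contra hb
        obtain rfl : b = 0 := by omega
        simp at hyv
        omega
      · by_contra hb
        obtain rfl : a = 0 := by omega
        simp at hxv
        omega
      -- Here `u` is less than `m` below `n`, so `u - am` stays in `[0, n)`, against `hxv`.
      · have e1 := circlePoint_val_of_mem hu0 hu1
        have e2 := circlePoint_val_of_mem (n := n) (z := u + m) (by omega) (by omega)
        have e3 := circlePoint_val_of_mem (n := n) (z := u - a * m) (by omega) (by omega)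
        omega
    · right; right
      -- For `a + b = p` the two vertices are `n - pm ≤ (p + 1)m` apart on an arc that does not
      -- contain the link.
      have hne : a + b ≠ p := by
        intro hp
        have habm' : (a * m + b * m : ℤ) = p * m := by
          rw [← hp]; push_cast; ring
        have hw := cutHarary_within_circle (u := u) b1 hmn hr0 hr (p + 1) (u - n + b * m)
          (n - p * m) (by omega) (by rw [natCast_succ_mul]; omega)
          (by rw [natCast_succ_mul]; omega) ?_ (by omega)
        · rw [show u - n + b * m + (n - p * m) = u - a * m by omega] at hw
          refine hn ?_
          rw [hx, hy, hp]
          exact hw.symm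
        · intro _ h6 j hj
          rw [natCast_succ_mul] at h6
          have := natCast_mul_le m (show j ≤ p by omega)
          have hj0 : (0 : ℤ) ≤ j * m := by positivity
          exact not_dvd_of_neg_mem (by omega) (by omega)
      exact ⟨by omega, hb1, hu, hx, hy⟩
  · have ha1' : (m : ℤ) ≤ a * m := by simpa using natCast_mul_le m ha1
    rcases cutHarary_far_end hR hr0 hr (by omega) h3 h4 with ⟨hy, hbr⟩ | ⟨-, hb1, hy, hu⟩
    · right; left
      have hne : a + b ≠ p := by
        intro hp
        have habm' : (a * m + b * m : ℤ) = p * m := by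
          rw [← hp]; push_cast; ring
        have hw := cutHarary_within_circle (u := u) b1 hmn hr0 hr (p + 1) (u + m + b * m)
          (n - p * m) (by omega) (by rw [natCast_succ_mul]; omega)
          (by rw [natCast_succ_mul]; omega) ?_ (by omega)
        · rw [show u + m + b * m + (n - p * m) = u + n + m - a * m by omega] at hw
          refine hn ?_
          rw [hx, hy, hp]
          exact hw.symm
        · intro _ h6 j hj
          rw [natCast_succ_mul] at h6
          have := natCast_mul_le m (show j ≤ p by omega)
          have hj0 : (0 : ℤ) ≤ j * m := by positivity
          exact not_dvd_of_mem (by omega) (by omega)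
      exact ⟨by omega, ha1, hv, hx, hy⟩
    -- The two long links would cancel up to one position, which leaves `x` and `y` within `a + b`
    -- short steps.
    · exfalso
      have hb1' : (m : ℤ) ≤ b * m := by simpa using natCast_mul_le m hb1
      have hw := within_circle_of_abs (fun z s => oddHarary_adj_circle hmn.le z) (a + b)
        (u + n + m - a * m) (u - n + b * m + (2 * n + 1)) (by push_cast; linarith)
        (by push_cast; linarith)
      refine hmin (a + b) (by omega) ?_
      rw [hx, hy, circlePoint_congr (z := u - n + b * m) (w := u - n + b * m + (2 * n + 1)) 1
        (by ring)]
      exact hw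

end ShortCut

/-! ### Pairs that need a long link -/

section LongCut

variable {m n p : ℕ} {u z s : ℤ}

theorem cutHarary_long_adj_circle (hmn : m < n) (z s : ℤ) (h0 : 0 < s) (hs : s ≤ m) :
    (cutHarary m n u (u + n)).Adj (circlePoint n z) (circlePoint n (z + s)) := by
  refine cutHarary_adj_of (oddHarary_adj_circle hmn.le z h0 hs) ?_ ?_
  · rintro ⟨h1, h2⟩
    have := dvd_sub h2 h1
    rw [show u + n - (z + s) - (u - z) = n - s by ring] at this
    exact not_dvd_of_mem (by omega) (by omega) this
  · rintro ⟨h1, h2⟩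
    have := dvd_sub h1 h2
    rw [show u + n - z - (u - (z + s)) = n + s by ring] at this
    exact not_dvd_of_mem (by omega) (by omega) this

theorem cutHarary_long_adj_chord (hn : 0 < n) (h : (circlePoint n z).val ≤ n)
    (hz : ¬ (2 * n + 1 : ℤ) ∣ u - z) :
    (cutHarary m n u (u + n)).Adj (circlePoint n z) (circlePoint n (z + n)) := by
  refine cutHarary_adj_of (oddHarary_adj_chord hn z h) (fun h => hz h.1) ?_
  rintro ⟨h1, h2⟩
  have := dvd_sub h1 h2
  rw [show u + n - z - (u - (z + n)) = 2 * n by ring] at this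
  exact not_dvd_of_mem (by omega) (by omega) this

theorem cutHarary_long_adj_chord' (hn : 0 < n) (h : n ≤ (circlePoint n z).val)
    (hz : ¬ (2 * n + 1 : ℤ) ∣ u + n - z) :
    (cutHarary m n u (u + n)).Adj (circlePoint n z) (circlePoint n (z + (n + 1))) := by
  refine cutHarary_adj_of (oddHarary_adj_chord' hn z h) ?_ (fun h => hz h.1)
  rintro ⟨h1, h2⟩
  have := dvd_sub h1 h2
  rw [show u - z - (u + n - (z + (n + 1))) = 1 by ring] at this
  exact not_dvd_of_mem (by omega) (by omega) this

/-- The vertices from which the long link `(u, u + n)` is needed to reach `u + n`. -/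
theorem cutHarary_long_near_end (hR : HararyRange m n p) (hu0 : 0 ≤ u) (hu1 : u ≤ n) {a : ℕ}
    (ha : a ≤ p) {x : Fin (2 * n + 1)} (hx : 1 ≤ a → x ≠ circlePoint n u)
    (h1 : (cutHarary m n u (u + n)).Within a x (circlePoint n u))
    (h2 : ¬ (cutHarary m n u (u + n)).Within (a + 1) x (circlePoint n (u + n))) :
    x = circlePoint n (u + a * m) ∧ (a = 0 ∨ n < u + a * m) := by
  have b1 := hR.two_lt
  have b3 := hR.lower
  have b5 := hR.le_mul
  zify at b3
  have hmn : m < n := by omega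
  have ham := natCast_mul_le m ha
  have ham0 : (0 : ℤ) ≤ a * m := by positivity
  obtain ⟨s, rfl, hs⟩ := oddHarary_within_subset b1 hmn.le u a x
    (h1.symm.mono_graph (SimpleGraph.deleteEdges_le _))
  rcases Nat.eq_zero_or_pos a with rfl | ha1
  · refine ⟨?_, Or.inl rfl⟩
    rcases hs with hs | hs
    · simp at hs
      have : s = 0 := by omega
      simp [this]
    · omega
  have hma : (m : ℤ) ≤ a * m := by simpa using natCast_mul_le m ha1
  have hH := cutHarary_long_adj_circle (m := m) (u := u) hmn
  rcases hs with hs | ⟨-, hs⟩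
  · have hs0 : s ≠ 0 := by
      rintro rfl
      exact hx ha1 (by rw [add_zero])
    have hd1 : ¬ (2 * n + 1 : ℤ) ∣ u - (u + s) := by
      rcases lt_or_gt_of_ne hs0 with h | h
      · exact not_dvd_of_mem (by omega) (by omega)
      · exact not_dvd_of_neg_mem (by omega) (by omega)
    have hd2 : ¬ (2 * n + 1 : ℤ) ∣ u + n - (u + s) := not_dvd_of_mem (by omega) (by omega)
    -- The long link at `x` itself is a substitute. It lands at offset `s` or `s + 1` from `u + n`,
    -- so `a` short steps fail only for `s = am`.
    rcases le_or_gt (circlePoint n (u + s)).val n with hv | hv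
    · exfalso
      have hadj := cutHarary_long_adj_chord (m := m) (by omega) hv hd1
      exact h2 (((SimpleGraph.Within.of_adj hadj).trans
        (within_circle_of_abs hH a _ _ (by omega) (by omega))).mono (by omega))
    · by_cases hend : s = a * m
      · subst hend
        have hval := circlePoint_val_of_mem (n := n) (z := u + a * m) (by omega) (by omega)
        exact ⟨rfl, Or.inr (by omega)⟩
      · exfalso
        have hadj := cutHarary_long_adj_chord' (m := m) (by omega) hv.le hd2
        exact h2 (((SimpleGraph.Within.of_adj hadj).trans
          (within_circle_of_abs hH a _ _ (by omega) (by omega))).mono (by omega))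
  · exact absurd ((within_circle_of_abs hH a (u + s) (u + n) (by omega) (by omega)).mono
      (by omega)) h2

/-- The long link at `u + am` lands `am + 1` beyond `u + n`, and `a + 1` short steps cover this.
Hence such a pair gets only one step further apart. -/
theorem cutHarary_long_within_near (hR : HararyRange m n p) (hu1 : u ≤ n) {a : ℕ}
    (ha : a ≤ p) (hua : n < u + a * m) :
    (cutHarary m n u (u + n)).Within (a + 2) (circlePoint n (u + a * m))
      (circlePoint n (u + n)) := by
  have b1 := hR.two_lt
  have b3 := hR.lower
  have b5 := hR.le_mul
  zify at b3
  have hmn : m < n := by omega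
  have ham := natCast_mul_le m ha
  have hval := circlePoint_val_of_mem (n := n) (z := u + a * m) (by omega) (by omega)
  have hadj := cutHarary_long_adj_chord' (m := m) (n := n) (u := u) (z := u + a * m) (by omega)
    (by omega) (not_dvd_of_mem (by omega) (by omega))
  exact ((SimpleGraph.Within.of_adj hadj).trans (within_circle_of_abs
    (cutHarary_long_adj_circle (m := m) (u := u) hmn) (a + 1) _ _
    (by rw [natCast_succ_mul]; omega) (by rw [natCast_succ_mul]; omega))).mono (by omega)

/-- The detour uses the parallel long link at `u + 1`, or at `u - 1` when `u = n`. -/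
theorem cutHarary_long_within_ends (hR : HararyRange m n p) (hu0 : 0 ≤ u) (hu1 : u ≤ n) :
    (cutHarary m n u (u + n)).Within 3 (circlePoint n u) (circlePoint n (u + n)) := by
  have b1 := hR.two_lt
  have b3 := hR.lower
  have b5 := hR.le_mul
  zify at b3
  have hmn : m < n := by omega
  have hH := within_circle_of_abs (cutHarary_long_adj_circle (m := m) (u := u) hmn) 1
  rcases hu1.lt_or_eq with h | h
  · have hval := circlePoint_val_of_mem (n := n) (z := u + 1) (by omega) (by omega)
    have hadj := cutHarary_long_adj_chord (m := m) (n := n) (u := u) (z := u + 1) (by omega) (by omega)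
      (not_dvd_of_neg_mem (by omega) (by omega))
    exact (((hH u (u + 1) (by simp; omega) (by simp; omega)).trans
      (SimpleGraph.Within.of_adj hadj)).trans
      (hH (u + 1 + n) (u + n) (by simp; omega) (by simp; omega))).mono (by omega)
  · have hval := circlePoint_val_of_mem (n := n) (z := u - 1) (by omega) (by omega)
    have hadj := cutHarary_long_adj_chord (m := m) (n := n) (u := u) (z := u - 1) (by omega) (by omega)
      (not_dvd_of_mem (by omega) (by omega))
    exact (((hH u (u - 1) (by simp; omega) (by simp; omega)).trans
      (SimpleGraph.Within.of_adj hadj)).trans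
      (hH (u - 1 + n) (u + n) (by simp; omega) (by simp; omega))).mono (by omega)

/-- The pairs of vertices that need a given long link. -/
theorem cutHarary_long_affected (hR : HararyRange m n p) (hu0 : 0 ≤ u) (hu1 : u ≤ n)
    {a b : ℕ} (hab : a + b ≤ p) {x y : Fin (2 * n + 1)}
    (hmin : ∀ j < a + b + 1, ¬ (oddHarary m n).Within j x y)
    (h1 : (cutHarary m n u (u + n)).Within a x (circlePoint n u))
    (h2 : ¬ (cutHarary m n u (u + n)).Within (a + 1) x (circlePoint n (u + n)))
    (h3 : (cutHarary m n u (u + n)).Within b (circlePoint n (u + n)) y)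
    (h4 : ¬ (cutHarary m n u (u + n)).Within (b + 1) (circlePoint n u) y) :
    (a + b = 0 ∧ x = circlePoint n u ∧ y = circlePoint n (u + n)) ∨
    (b = 0 ∧ 1 ≤ a ∧ x = circlePoint n (u + a * m) ∧ y = circlePoint n (u + n) ∧
      (cutHarary m n u (u + n)).Within (a + b + 2) x y) ∨
    (a = 0 ∧ 1 ≤ b ∧ x = circlePoint n u ∧ y = circlePoint n (u + n - b * m) ∧
      (cutHarary m n u (u + n)).Within (a + b + 2) x y) := by
  have b1 := hR.two_lt
  have b3 := hR.lower
  have b5 := hR.le_mul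
  zify at b3
  have hmn : m < n := by omega
  have hle : cutHarary m n u (u + n) ≤ oddHarary m n := SimpleGraph.deleteEdges_le _
  have hval := circlePoint_val_of_mem hu0 (show u ≤ 2 * n by omega)
  have huv : (oddHarary m n).Within 1 (circlePoint n u) (circlePoint n (u + n)) :=
    SimpleGraph.Within.of_adj (oddHarary_adj_chord (by omega) u (by omega))
  have hxne : 1 ≤ a → x ≠ circlePoint n u := by
    rintro ha rfl
    exact hmin (1 + b) (by omega) (huv.trans (h3.mono_graph hle))
  have hyne : 1 ≤ b → y ≠ circlePoint n (u + n) := by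
    rintro hb rfl
    exact hmin (a + 1) (by omega) ((h1.mono_graph hle).trans huv)
  have e1 : ∀ z : ℤ, 2 * (n : ℤ) - (2 * n - z) = z := fun z => by ring
  have e2 : 2 * (n : ℤ) - (u + n) = n - u := by ring
  have e3 : 2 * (n : ℤ) - u = n - u + n := by ring
  have hreflect : ∀ {k : ℕ} {z w : ℤ},
      (cutHarary m n u (u + n)).Within k (circlePoint n z) (circlePoint n w) →
      (cutHarary m n (n - u) (n - u + n)).Within k (circlePoint n (2 * n - z))
        (circlePoint n (2 * n - w)) := by
    intro k z w h
    have := cutHarary_within_reflect hmn.le h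
    rwa [e2, e3] at this
  have hreflect' : ∀ {k : ℕ} {z w : ℤ},
      (cutHarary m n (n - u) (n - u + n)).Within k (circlePoint n (2 * n - z))
        (circlePoint n (2 * n - w)) →
      (cutHarary m n u (u + n)).Within k (circlePoint n z) (circlePoint n w) := by
    intro k z w h
    have := cutHarary_within_reflect hmn.le h
    rwa [e1, e1, show 2 * (n : ℤ) - (n - u + n) = u by ring,
      show 2 * (n : ℤ) - (n - u) = u + n by ring] at this
  obtain ⟨w, -, -, rfl⟩ := exists_eq_circlePoint y
  obtain ⟨hx, hxa⟩ := cutHarary_long_near_end hR hu0 hu1 (by omega) hxne h1 h2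
  obtain ⟨hy, hyb⟩ := cutHarary_long_near_end (u := n - u) (a := b) hR (by omega) (by omega)
    (by omega) (x := circlePoint n (2 * n - w))
    (fun hb h => hyne hb (circlePoint_reflect_inj (by rw [h, e2])))
    (by have := hreflect h3; rw [e2] at this; exact this.symm)
    (fun h => h4 (hreflect' (by rw [e3]; exact h.symm)))
  have hy' : circlePoint n w = circlePoint n (u + n - b * m) := by
    apply circlePoint_reflect_inj
    rw [hy]; congr 1; ring
  rcases Nat.eq_zero_or_pos a with rfl | ha1 <;> rcases Nat.eq_zero_or_pos b with rfl | hb1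
  · left
    simp at hx hy'
    exact ⟨rfl, hx, hy'⟩
  · right; right
    simp at hx
    refine ⟨rfl, hb1, hx, hy', ?_⟩
    have := cutHarary_long_within_near (u := n - u) hR (by omega)
      (show b ≤ p by omega) (by omega)
    rw [← hy] at this
    rw [hx, zero_add]
    exact (hreflect' (by rw [e3]; exact this)).symm
  · right; left
    simp at hy'
    refine ⟨rfl, ha1, hx, hy', ?_⟩
    rw [hx, hy', add_zero]
    exact cutHarary_long_within_near hR hu1 (by omega) (by omega)
  -- Adding `n < u + am` and `n < n - u + bm` gives `n < (a + b)m ≤ pm`, against the lower bound on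
  -- `n`.
  · exfalso
    have := natCast_mul_le m hab
    push_cast at this
    have h5 : (a * m + b * m : ℤ) ≤ p * m := by linarith
    omega

end LongCut

/-! ### Pairs affected by a deletion -/

section Affected

variable {V : Type*} {G : SimpleGraph V} {u v : V}

theorem pairCloseness_sub_le {H : SimpleGraph V} {k l : ℕ} {x y : V}
    (h : ∀ j < k + 1, ¬ G.Within j x y) (h' : H.Within l x y) :
    pairCloseness G x y - pairCloseness H x y ≤ (1 / 2 : ℝ) ^ (k + 1) - (1 / 2) ^ l := by
  have h1 := pairCloseness_le_of_not_within (h k (by omega))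
  have h2 := h'.le_pairCloseness
  linarith

/-- A pair whose closeness drops when the link `s(u, v)` is removed, oriented along that link. -/
theorem exists_affected (huv : G.Adj u v) {D : ℕ} (hD : ∀ x y, G.Within D x y) (i : V × V)
    (hi : 0 < pairCloseness G i.1 i.2 - pairCloseness (G.deleteEdges {s(u, v)}) i.1 i.2) :
    ∃ x y a b, ((x, y) = i ∨ (x, y) = i.swap) ∧ a + b + 1 ≤ D ∧
      pairCloseness G i.1 i.2 - pairCloseness (G.deleteEdges {s(u, v)}) i.1 i.2 =
        pairCloseness G x y - pairCloseness (G.deleteEdges {s(u, v)}) x y ∧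
      (∀ j < a + b + 1, ¬ G.Within j x y) ∧
      ¬ (G.deleteEdges {s(u, v)}).Within (a + b + 1) x y ∧
      (G.deleteEdges {s(u, v)}).Within a x u ∧ ¬ (G.deleteEdges {s(u, v)}).Within (a + 1) x v ∧
      (G.deleteEdges {s(u, v)}).Within b v y ∧
      ¬ (G.deleteEdges {s(u, v)}).Within (b + 1) u y := by
  obtain ⟨x, y⟩ := i
  have hdist := (hD x y).dist
  have hmin : ∀ j < G.dist x y, ¬ G.Within j x y := fun j hj h =>
    absurd h.dist_le (not_le.mpr hj)
  have hn : ¬ (G.deleteEdges {s(u, v)}).Within (G.dist x y) x y := fun h => by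
    have h1 := h.le_pairCloseness
    rw [← pairCloseness_eq hdist] at h1
    simp only at hi
    linarith
  obtain ⟨a, b, hab, ⟨h1, h2, h3, h4⟩ | ⟨h1, h2, h3, h4⟩⟩ := hdist.exists_split_of_not huv hmin hn
  · refine ⟨x, y, a, b, Or.inl rfl, hab ▸ (hD x y).dist_le, rfl, ?_, ?_, h1, h3, h2, h4⟩
    · rw [hab]; exact hmin
    · rw [hab]; exact hn
  · have hba : b + a + 1 = G.dist x y := by omega
    refine ⟨y, x, b, a, Or.inr rfl, hba ▸ (hD x y).dist_le, ?_, ?_, ?_, h2.symm,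
      fun h => h4 h.symm, h1.symm, fun h => h3 h.symm⟩
    · simp only [pairCloseness_comm _ y x]
    · rw [hba]; exact fun j hj h => hmin j hj h.symm
    · rw [hba]; exact fun h => hn h.symm

end Affected

/-! ### Numerical sums and the final inequality -/

section Series

theorem sum_succ_mul_half_pow (p : ℕ) :
    ∑ k ∈ Finset.range p, ((k : ℝ) + 1) * (1 / 2) ^ (k + 2) = 1 - (p + 2) / 2 * (1 / 2) ^ p := by
  induction p with
  | zero => norm_num
  | succ p ih => rw [Finset.sum_range_succ, ih, pow_succ, pow_succ]; push_cast; ring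

theorem sum_mul_half_pow (p : ℕ) :
    ∑ k ∈ Finset.range p, (k : ℝ) * (1 / 2) ^ (k + 2) = 1 / 2 - (p + 1) / 2 * (1 / 2) ^ p := by
  induction p with
  | zero => norm_num
  | succ p ih => rw [Finset.sum_range_succ, ih, pow_succ, pow_succ]; push_cast; ring

theorem sum_half_pow (p : ℕ) :
    ∑ k ∈ Finset.range p, (1 / 2 : ℝ) ^ (k + 3) = 1 / 4 - 1 / 4 * (1 / 2) ^ p := by
  induction p with
  | zero => norm_num
  | succ p ih => rw [Finset.sum_range_succ, ih, pow_succ, pow_succ]; ring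

/-- This is the comparison needed when exactly one mixed family is absent; equality holds at `p =
2`. -/
theorem half_pow_bound {p : ℕ} (hp : 2 ≤ p) : (3 / 2 * p + 1) * (1 / 2 : ℝ) ^ p ≤ 1 := by
  induction p, hp using Nat.le_induction with
  | base => norm_num
  | succ p hp ih =>
    have h0 : (0 : ℝ) ≤ (1 / 2) ^ p := by positivity
    have h1 : (2 : ℝ) ≤ p := by exact_mod_cast hp
    have h2 : (0 : ℝ) ≤ p * (1 / 2) ^ p := by positivity
    rw [pow_succ]
    push_cast
    nlinarith

end Series

/-! ### Upper bounds for the loss -/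

section Loss

variable {m n p : ℕ} {u r : ℤ}

/-- Removing a short link costs at most `4 - (3 * p + 4) * 2⁻ᵖ`. -/
theorem closeness_sub_cut_le (hR : HararyRange m n p) (hu0 : 0 ≤ u) (hu1 : u ≤ 2 * n)
    (hr0 : 0 < r) (hr : r ≤ m) :
    closeness (oddHarary m n) - closeness (cutHarary m n u (u + r)) ≤
      4 - (3 * p + 4) * (1 / 2 : ℝ) ^ p := by
  classical
  have b1 := hR.two_lt
  have b2 := hR.two_le
  have b3 := hR.lower
  have b5 := hR.le_mul
  zify at b3
  have hmn : m < n := by omega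
  rw [closeness_sub_closeness]
  set A : Prop := n < (circlePoint n (u + r)).val with hA
  set B : Prop := (circlePoint n u).val < n with hB
  -- In an index `⟨k, a⟩`, `k` is `a + b`. `T1` serves the circle pairs and `T0` a mixed family; in
  -- the family with `a ≥ 1` the second entry is `a - 1`. `T4` indexes the circle pairs with `a + b
  -- = p`.
  set T1 : Finset (Σ _ : ℕ, ℕ) := (Finset.range p).sigma fun k => Finset.range (k + 1) with hT1
  set T0 : Finset (Σ _ : ℕ, ℕ) := (Finset.range p).sigma fun k => Finset.range k with hT0
  set T2 : Finset (Σ _ : ℕ, ℕ) := if A then T0 else ∅ with hT2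
  set T3 : Finset (Σ _ : ℕ, ℕ) := if B then T0 else ∅ with hT3
  set T4 : Finset ℕ := (Finset.range (p + 1)).filter
    fun a => (A → a < p) ∧ (B → 1 ≤ a) ∧ ¬ (B ∧ A) with hT4
  set P : ℕ → Fin (2 * n + 1) := fun a => circlePoint n (u - a * m) with hP
  set Q : ℕ → Fin (2 * n + 1) := fun b => circlePoint n (u + r + b * m) with hQ
  set w : (Σ _ : ℕ, ℕ) → ℝ := fun j => (1 / 2 : ℝ) ^ (j.1 + 2) with hw
  have hcov := sum_pairs_le_of_cover
    (fun i => pairCloseness (oddHarary m n) i.1 i.2 -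
      pairCloseness (cutHarary m n u (u + r)) i.1 i.2)
    (T1.disjSum (T2.disjSum (T3.disjSum T4)))
    (Sum.elim (fun j => (P j.2, Q (j.1 - j.2)))
      (Sum.elim (fun j => (circlePoint n (u + n + m - ((j.2 + 1 : ℕ) : ℤ) * m), Q (j.1 - (j.2 + 1))))
        (Sum.elim (fun j => (P j.2, circlePoint n (u - n + ((j.1 - j.2 : ℕ) : ℤ) * m)))
          (fun a => (P a, Q (p - a))))))
    (Sum.elim w (Sum.elim w (Sum.elim w fun _ => (1 / 2 : ℝ) ^ (p + 2)))) ?_ ?_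
  · refine hcov.trans ?_
    rw [Finset.sum_disjSum, Finset.sum_disjSum, Finset.sum_disjSum]
    simp only [Sum.elim_inl, Sum.elim_inr, Finset.sum_const, nsmul_eq_mul]
    have s1 : ∑ j ∈ T1, w j = 1 - (p + 2) / 2 * (1 / 2) ^ p := by
      rw [hT1, Finset.sum_sigma, ← sum_succ_mul_half_pow]
      simp [hw]
    have s0 : ∑ j ∈ T0, w j = 1 / 2 - (p + 1) / 2 * (1 / 2) ^ p := by
      rw [hT0, Finset.sum_sigma, ← sum_mul_half_pow]
      simp [hw]
    have h0 : (0 : ℝ) ≤ (1 / 2) ^ p := by positivity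
    have h1 := half_pow_bound b2
    have h2 : 2 * (1 / 2 : ℝ) ^ p ≤ p * (1 / 2) ^ p :=
      mul_le_mul_of_nonneg_right (by exact_mod_cast b2) h0
    have hc : ∀ c : ℕ, T4.card ≤ c → (T4.card : ℝ) * (1 / 2) ^ (p + 2) ≤ c * (1 / 2) ^ (p + 2) :=
      fun c hc => mul_le_mul_of_nonneg_right (by exact_mod_cast hc) (by positivity)
    rw [pow_add] at hc ⊢
    rw [s1]
    -- With `q = 2^-p` the totals are at most `4 - (3p + 4)q` if both hold, `3 - (3p/2 + 3)q` if one
    -- holds, and `2 - (p + 3)q/2` if neither does.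
    by_cases hA' : A <;> by_cases hB' : B
    · have hcard : T4.card = 0 := by simp [hT4, hA', hB']
      simp only [hT2, hT3, if_pos hA', if_pos hB', s0, hcard]
      push_cast
      linarith
    · have hcard := hc p (by
        calc T4.card ≤ (Finset.range p).card := Finset.card_le_card fun a ha => by
              simp [hT4, hA', hB'] at ha ⊢; omega
          _ = p := by simp)
      simp only [hT2, hT3, if_pos hA', if_neg hB', s0, Finset.sum_empty]
      linarith
    · have hcard := hc p (by
        calc T4.card ≤ (Finset.Ico 1 (p + 1)).card := Finset.card_le_card fun a ha => by
              simp [hT4, hA', hB'] at ha ⊢; omega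
          _ = p := by simp)
      simp only [hT2, hT3, if_neg hA', if_pos hB', s0, Finset.sum_empty]
      linarith
    · have hcard := hc (p + 1) (by
        calc T4.card ≤ (Finset.range (p + 1)).card := Finset.card_le_card (Finset.filter_subset _ _)
          _ = p + 1 := by simp)
      simp only [hT2, hT3, if_neg hA', if_neg hB', Finset.sum_empty]
      push_cast at hcard
      linarith
  · rintro (j | j | j | j) - <;> simp only [Sum.elim_inl, Sum.elim_inr, hw] <;> positivity
  · intro i hi
    obtain ⟨x, y, a, b, hxy, hab, hval, hmin, hn, h1, h2, h3, h4⟩ :=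
      exists_affected (oddHarary_adj_circle hmn.le u hr0 hr) (oddHarary_within_diam hR) i hi
    -- Replacing the link by two steps adds one to the distance, so the loss is at most `2^-(k+1) -
    -- 2^-(k+2) = 2^-(k+2)` with `k = a + b`.
    have huv : (cutHarary m n u (u + r)).Within 2 (circlePoint n u) (circlePoint n (u + r)) :=
      cutHarary_within_of_lt b1 hmn hr0 hr le_rfl (by push_cast; omega) (by push_cast; omega)
        (by push_cast; omega)
    have hloss := pairCloseness_sub_le hmin ((h1.trans huv).trans h3)
    have hloss' : pairCloseness (oddHarary m n) i.1 i.2 -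
        pairCloseness (cutHarary m n u (u + r)) i.1 i.2 ≤ (1 / 2 : ℝ) ^ (a + b + 2) := by
      rw [hval]
      refine hloss.trans (le_of_eq ?_)
      rw [show a + 2 + b = a + b + 2 by ring, pow_succ _ (a + b + 1)]
      ring
    rcases cutHarary_affected hR hu0 hu1 hr0 hr (by omega) hmin hn h1 h2 h3 h4 with
      ⟨rfl, rfl, hp⟩ | ⟨hlt, ha1, hv, rfl, rfl⟩ | ⟨hlt, hb1, hu, rfl, rfl⟩
    · rcases (show a + b < p ∨ a + b = p by omega) with hlt | heq
      · refine ⟨Sum.inl ⟨a + b, a⟩, ?_, ?_, hloss'⟩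
        · simp [hT1]; omega
        · simpa [hP, hQ] using hxy
      · obtain ⟨hp1, hp2, hp3⟩ := hp heq
        refine ⟨Sum.inr (Sum.inr (Sum.inr a)), ?_, ?_, ?_⟩
        · simp only [Finset.inr_mem_disjSum, hT4, Finset.mem_filter, Finset.mem_range]
          exact ⟨by omega, fun h => by have := hp1 h; omega, hp2, hp3⟩
        · simpa [hP, hQ, show p - a = b by omega] using hxy
        · rw [← heq]; exact hloss'
    · refine ⟨Sum.inr (Sum.inl ⟨a + b, a - 1⟩), ?_, ?_, hloss'⟩
      · have hT : T2 = T0 := if_pos hv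
        simp only [Finset.inr_mem_disjSum, Finset.inl_mem_disjSum, hT]
        simp only [hT0, Finset.mem_sigma, Finset.mem_range]
        omega
      · simpa only [Sum.elim_inl, Sum.elim_inr, show a - 1 + 1 = a by omega,
          show a + b - a = b by omega] using hxy
    · refine ⟨Sum.inr (Sum.inr (Sum.inl ⟨a + b, a⟩)), ?_, ?_, hloss'⟩
      · have hT : T3 = T0 := if_pos hu
        simp only [Finset.inr_mem_disjSum, Finset.inl_mem_disjSum, hT]
        simp only [hT0, Finset.mem_sigma, Finset.mem_range]
        omega
      · simpa only [Sum.elim_inl, Sum.elim_inr, show a + b - a = b by omega] using hxy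

/-- Removing a long link costs at most `4 - (3 * p + 4) * 2⁻ᵖ`. -/
theorem closeness_sub_long_cut_le (hR : HararyRange m n p) (hu0 : 0 ≤ u) (hu1 : u ≤ n) :
    closeness (oddHarary m n) - closeness (cutHarary m n u (u + n)) ≤
      4 - (3 * p + 4) * (1 / 2 : ℝ) ^ p := by
  have b1 := hR.two_lt
  have b2 := hR.two_le
  have b3 := hR.lower
  have b5 := hR.le_mul
  zify at b3
  have hmn : m < n := by omega
  rw [closeness_sub_closeness]
  have hcov := sum_pairs_le_of_cover
    (fun i => pairCloseness (oddHarary m n) i.1 i.2 -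
      pairCloseness (cutHarary m n u (u + n)) i.1 i.2)
    ((Finset.range 1).disjSum ((Finset.range p).disjSum (Finset.range p)))
    (Sum.elim (fun _ => (circlePoint n u, circlePoint n (u + n)))
      (Sum.elim (fun a => (circlePoint n (u + ((a + 1 : ℕ) : ℤ) * m), circlePoint n (u + n)))
        (fun b => (circlePoint n u, circlePoint n (u + n - ((b + 1 : ℕ) : ℤ) * m)))))
    -- The ends of the link go from distance 1 to at most 3, and `1/2 - 1/8 = 3/8`.
    (Sum.elim (fun _ => 3 / 8)
      (Sum.elim (fun a => (1 / 2 : ℝ) ^ (a + 3)) fun b => (1 / 2 : ℝ) ^ (b + 3))) ?_ ?_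
  · refine hcov.trans ?_
    rw [Finset.sum_disjSum, Finset.sum_disjSum]
    simp only [Sum.elim_inl, Sum.elim_inr, Finset.sum_const, nsmul_eq_mul, sum_half_pow]
    have h0 : (0 : ℝ) ≤ (1 / 2) ^ p := by positivity
    have h1 := half_pow_bound b2
    have h2 : 2 * (1 / 2 : ℝ) ^ p ≤ p * (1 / 2) ^ p :=
      mul_le_mul_of_nonneg_right (by exact_mod_cast b2) h0
    simp only [Finset.card_range, Nat.cast_one]
    linarith
  · rintro (j | j | j) - <;> simp only [Sum.elim_inl, Sum.elim_inr] <;> positivity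
  · intro i hi
    have hval := circlePoint_val_of_mem hu0 (show u ≤ 2 * n by omega)
    obtain ⟨x, y, a, b, hxy, hab, hval, hmin, hn, h1, h2, h3, h4⟩ :=
      exists_affected (oddHarary_adj_chord (by omega) u (by omega)) (oddHarary_within_diam hR) i hi
    have hpow : ∀ k : ℕ, (1 / 2 : ℝ) ^ (k + 1) - (1 / 2) ^ (k + 2) = (1 / 2) ^ (k + 2) := by
      intro k; rw [pow_succ _ (k + 1)]; ring
    rcases cutHarary_long_affected hR hu0 hu1 (by omega) hmin h1 h2 h3 h4 with
      ⟨hab0, rfl, rfl⟩ | ⟨rfl, ha1, rfl, rfl, hw⟩ | ⟨rfl, hb1, rfl, rfl, hw⟩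
    · refine ⟨Sum.inl 0, by simp, by simpa using hxy, ?_⟩
      rw [hab0] at hmin
      have hloss := pairCloseness_sub_le hmin (cutHarary_long_within_ends (m := m) hR hu0 hu1)
      rw [hval]
      refine hloss.trans ?_
      simp only [Sum.elim_inl]
      norm_num
    · refine ⟨Sum.inr (Sum.inl (a - 1)), by simp; omega, ?_, ?_⟩
      · simpa only [Sum.elim_inl, Sum.elim_inr, show a - 1 + 1 = a by omega] using hxy
      · have hloss := pairCloseness_sub_le hmin hw
        rw [hpow] at hloss
        rw [hval]
        simpa only [Sum.elim_inl, Sum.elim_inr, show a - 1 + 3 = a + 0 + 2 by omega] using hloss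
    · refine ⟨Sum.inr (Sum.inr (b - 1)), by simp; omega, ?_, ?_⟩
      · simpa only [Sum.elim_inl, Sum.elim_inr, show b - 1 + 1 = b by omega] using hxy
      · have hloss := pairCloseness_sub_le hmin hw
        rw [hpow] at hloss
        rw [hval]
        simpa only [Sum.elim_inl, Sum.elim_inr, show b - 1 + 3 = 0 + b + 2 by omega] using hloss

end Loss

/-! ### Lower bound for the extremal link -/

section Extremal

variable {m n p : ℕ} {u : ℤ}

/-- The ball around a vertex behind a link of length `m` that is close to the vertex with two long
links, when that link is missing. -/
theorem cutHarary_within_subset (hR : HararyRange m n p) (hu0 : n ≤ u + m) (hu1 : u < n) {a : ℕ}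
    (ha : a < p) (k : ℕ) (y : Fin (2 * n + 1))
    (h : (cutHarary m n u (u + m)).Within k (circlePoint n (u - a * m)) y) :
    k ≤ p → ∃ s : ℤ, y = circlePoint n (u - a * m + s) ∧
      ((-(k * m : ℤ) ≤ s ∧ s ≤ k * m ∧ (a < k → s < k * m)) ∨
      (1 ≤ k ∧ (n : ℤ) + m - k * m ≤ s ∧ s ≤ n + k * m - m)) := by
  have b1 := hR.two_lt
  have b3 := hR.lower
  have b5 := hR.le_mul
  zify at b3
  have hmn : m < n := by omega
  have ham := natCast_mul_le m (show a + 1 ≤ p from ha)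
  rw [natCast_succ_mul] at ham
  revert k y h
  refine SimpleGraph.Within.rec_snoc (fun _ => ⟨0, by simp⟩) ?_ ?_
  · intro k y ih hk
    obtain ⟨s, rfl, h⟩ := ih (by omega)
    refine ⟨s, rfl, ?_⟩
    rw [natCast_succ_mul]
    rcases h with ⟨h1, h2, -⟩ | h
    · exact Or.inl ⟨by omega, by omega, fun _ => by omega⟩
    · exact Or.inr (by omega)
  · intro k y y' ih hadj hk
    obtain ⟨s, rfl, h⟩ := ih (by omega)
    rw [SimpleGraph.deleteEdges_adj] at hadj
    obtain ⟨d, hy', -, hd⟩ := oddHarary_adj_cases hmn.le hadj.1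
    rw [hy'] at hadj ⊢
    clear hy' ih
    have hkm := natCast_mul_le m (show k ≤ p by omega)
    have hk0 : (0 : ℤ) ≤ k * m := by positivity
    rw [natCast_succ_mul]
    rcases h with ⟨h1, h2, h3⟩ | h
    · rcases hd with hd | ⟨hd', hd⟩ | ⟨hd', hd⟩
      · refine ⟨s + d, by rw [add_assoc], Or.inl ⟨by omega, by omega, fun hak => ?_⟩⟩
        rcases (show a < k ∨ a = k by omega) with h | rfl
        · have := h3 h
          omega
        · by_contra hlt
          have hs : s = a * m := by omega
          have hdm : d = m := by omega
          refine hadj.2 ?_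
          rw [hs, hdm, sub_add_cancel]
          rfl
      · exact ⟨s + d, by rw [add_assoc], by omega⟩
      · refine ⟨s + d, by rw [add_assoc], ?_⟩
        -- With `s = km` and `k ≤ a` the position is at most `u < n`, where no long link of
        -- displacement `n + 1` starts. So the far arc ends one position earlier than in the full
        -- graph.
        have hs : s < k * m := by
          rcases lt_or_ge a k with h | h
          · exact h3 h
          · by_contra hlt
            have hs : s = k * m := by omega
            rw [hs] at hd
            have := natCast_mul_le m h
            have := circlePoint_val_of_mem (n := n) (z := u - a * m + k * m) (by omega) (by omega)
            omega
        omega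
    · rcases hd with hd | hd | hd
      · exact ⟨s + d, by rw [add_assoc], by omega⟩
      · exact ⟨s + d - (2 * n + 1), circlePoint_congr (-1) (by ring), by omega⟩
      · exact ⟨s + d - (2 * n + 1), circlePoint_congr (-1) (by ring), by omega⟩

/-- The displacement is the extreme value `(a + b + 1)m`, which the near arc has lost since `a < a +
b + 1`; the far arc begins beyond it because `a + b < p`. -/
theorem cutHarary_not_within_circle (hR : HararyRange m n p) (hu0 : n ≤ u + m) (hu1 : u < n)
    {a b : ℕ} (hab : a + b < p) :
    ¬ (cutHarary m n u (u + m)).Within (a + b + 1) (circlePoint n (u - a * m))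
      (circlePoint n (u + m + b * m)) := by
  intro h
  have b1 := hR.two_lt
  have b3 := hR.lower
  have b5 := hR.le_mul
  zify at b3
  obtain ⟨s, hs, h⟩ := cutHarary_within_subset hR hu0 hu1 (by omega) _ _ h (by omega)
  have hd := circlePoint_eq_iff.mp hs
  have hk := natCast_mul_le m (show a + b + 1 ≤ p by omega)
  have e : ((a + b + 1 : ℕ) : ℤ) * m = a * m + b * m + m := by push_cast; ring
  rw [e] at h hk
  have ha0 : (0 : ℤ) ≤ a * m := by positivity
  have hb0 : (0 : ℤ) ≤ b * m := by positivity
  rcases h with ⟨h1, -, h3⟩ | ⟨-, h⟩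
  · have := h3 (by omega)
    exact not_dvd_of_neg_mem (by omega) (by omega) hd
  · exact not_dvd_of_mem (by omega) (by omega) hd

/-- With `k = a + b + 1` the displacement is `n + 1 + km - m` modulo a turn, just one position
beyond the far arc. -/
theorem cutHarary_not_within_near (hR : HararyRange m n p) (hu0 : n ≤ u + m) (hu1 : u < n)
    {a b : ℕ} (hab : a + b < p) :
    ¬ (cutHarary m n u (u + m)).Within (a + b + 1) (circlePoint n (u - a * m))
      (circlePoint n (u - n + b * m)) := by
  intro h
  have b1 := hR.two_lt
  have b3 := hR.lower
  have b5 := hR.le_mul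
  zify at b3
  obtain ⟨s, hs, h⟩ := cutHarary_within_subset hR hu0 hu1 (by omega) _ _ h (by omega)
  rw [circlePoint_congr (z := u - n + b * m) (w := u - n + b * m + (2 * n + 1)) 1 (by ring)] at hs
  have hd := circlePoint_eq_iff.mp hs
  have hk := natCast_mul_le m (show a + b + 1 ≤ p by omega)
  have e : ((a + b + 1 : ℕ) : ℤ) * m = a * m + b * m + m := by push_cast; ring
  rw [e] at h hk
  have ha0 : (0 : ℤ) ≤ a * m := by positivity
  have hb0 : (0 : ℤ) ≤ b * m := by positivity
  rcases h with ⟨h1, -, h3⟩ | ⟨-, h⟩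
  · have := h3 (by omega)
    exact not_dvd_of_neg_mem (by omega) (by omega) hd
  · exact not_dvd_of_neg_mem (by omega) (by omega) hd

theorem cutHarary_not_within_far (hR : HararyRange m n p) (hu0 : n < u + m) (hu1 : u ≤ n)
    {a b : ℕ} (hab : a + b < p) :
    ¬ (cutHarary m n u (u + m)).Within (a + b + 1) (circlePoint n (u + m + b * m))
      (circlePoint n (u + n + m - a * m)) := by
  intro h
  have b1 := hR.two_lt
  have b3 := hR.lower
  have b5 := hR.le_mul
  zify at b3
  have h' := cutHarary_within_reflect (by omega) h
  refine cutHarary_not_within_near (u := 2 * n - (u + m)) (a := b) (b := a) hR (by omega)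
    (by omega) (by omega) ?_
  rw [show 2 * (n : ℤ) - (u + m) + m = 2 * n - u by ring, add_comm b a]
  rwa [show 2 * (n : ℤ) - (u + m + b * m) = 2 * n - (u + m) - b * m by ring,
    show 2 * (n : ℤ) - (u + n + m - a * m) = 2 * n - (u + m) - n + a * m by ring] at h'

/-- The walk makes `a + 1` steps of length `m` to `u + m`, takes the long link there, and makes `b -
1` more such steps. -/
theorem oddHarary_within_near (hR : HararyRange m n p) (hu0 : n ≤ u + m) (hu1 : u < n)
    {a b : ℕ} (hb : 1 ≤ b) :
    (oddHarary m n).Within (a + b + 1) (circlePoint n (u - a * m))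
      (circlePoint n (u - n + b * m)) := by
  have b1 := hR.two_lt
  have b3 := hR.lower
  have b5 := hR.le_mul
  zify at b3
  have hmn : m < n := by omega
  obtain ⟨b, rfl⟩ : ∃ c, b = c + 1 := ⟨b - 1, by omega⟩
  have ha0 : (0 : ℤ) ≤ a * m := by positivity
  have hb0 : (0 : ℤ) ≤ b * m := by positivity
  have hH := within_circle_of_abs fun z s => oddHarary_adj_circle (m := m) (n := n) hmn.le z
  have hval := circlePoint_val_of_mem (n := n) (z := u + m) (by omega) (by omega)
  have hadj := oddHarary_adj_chord' (m := m) (n := n) (by omega) (u + m) (by omega)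
  rw [circlePoint_congr (z := u - n + ((b + 1 : ℕ) : ℤ) * m)
    (w := u - n + ((b + 1 : ℕ) : ℤ) * m + (2 * n + 1)) 1 (by ring)]
  refine (((hH (a + 1) (u - a * m) (u + m) ?_ ?_).trans (SimpleGraph.Within.of_adj hadj)).trans
    (hH b _ _ ?_ ?_)).mono (by omega) <;> simp only [natCast_succ_mul] <;> omega

theorem oddHarary_within_far (hR : HararyRange m n p) (hu0 : 0 ≤ u) (hu1 : u ≤ n)
    {a b : ℕ} (ha : 1 ≤ a) :
    (oddHarary m n).Within (a + b + 1) (circlePoint n (u + m + b * m))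
      (circlePoint n (u + n + m - a * m)) := by
  have b1 := hR.two_lt
  have b3 := hR.lower
  have b5 := hR.le_mul
  zify at b3
  have hmn : m < n := by omega
  obtain ⟨a, rfl⟩ : ∃ c, a = c + 1 := ⟨a - 1, by omega⟩
  have ha0 : (0 : ℤ) ≤ a * m := by positivity
  have hb0 : (0 : ℤ) ≤ b * m := by positivity
  have hH := within_circle_of_abs fun z s => oddHarary_adj_circle (m := m) (n := n) hmn.le z
  have hval := circlePoint_val_of_mem (n := n) (z := u) (by omega) (by omega)
  have hadj := oddHarary_adj_chord (m := m) (n := n) (by omega) u (by omega)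
  refine (((hH (b + 1) (u + m + b * m) u ?_ ?_).trans (SimpleGraph.Within.of_adj hadj)).trans
    (hH a _ _ ?_ ?_)).mono (by omega) <;> simp only [natCast_succ_mul] <;> omega

/-- A lower bound for a symmetric sum over ordered pairs by a family of increasing pairs. -/
theorem two_mul_sum_le_sum_pairs {V ι : Type*} [Fintype V] [LinearOrder V] (f : V × V → ℝ)
    (hf : ∀ i, 0 ≤ f i) (hsymm : ∀ i, f i.swap = f i) (T : Finset ι) (g : ι → V × V)
    (hg : Set.InjOn g T) (hlt : ∀ j ∈ T, (g j).1 < (g j).2) (w : ι → ℝ)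
    (hw : ∀ j ∈ T, w j ≤ f (g j)) :
    2 * ∑ j ∈ T, w j ≤ ∑ i, f i := by
  classical
  set S := T.image g with hS
  have h1 : ∑ j ∈ T, w j ≤ ∑ i ∈ S, f i := by
    rw [hS, Finset.sum_image hg]
    exact Finset.sum_le_sum hw
  have h2 : ∑ i ∈ S.image Prod.swap, f i = ∑ i ∈ S, f i := by
    rw [Finset.sum_image Prod.swap_injective.injOn]
    exact Finset.sum_congr rfl fun i _ => hsymm i
  have hSlt : ∀ i ∈ S, i.1 < i.2 := by
    intro i hi
    obtain ⟨j, hj, rfl⟩ := Finset.mem_image.mp hi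
    exact hlt j hj
  have hdisj : Disjoint S (S.image Prod.swap) := by
    rw [Finset.disjoint_left]
    intro i hi hi'
    obtain ⟨j, hj, rfl⟩ := Finset.mem_image.mp hi'
    exact lt_asymm (hSlt _ hi) (hSlt _ hj)
  have h3 : ∑ i ∈ S ∪ S.image Prod.swap, f i ≤ ∑ i, f i :=
    Finset.sum_le_sum_of_subset_of_nonneg (Finset.subset_univ _) fun i _ _ => hf i
  rw [Finset.sum_union hdisj, h2] at h3
  linarith

/-- For `u = n - 1` all three families are present. Explicit coordinates show their pairs to be
distinct and increasing, so each counts twice among ordered pairs. -/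
theorem le_closeness_sub_cut (hR : HararyRange m n p) :
    4 - (3 * p + 4) * (1 / 2 : ℝ) ^ p ≤
      closeness (oddHarary m n) - closeness (cutHarary m n (n - 1) (n - 1 + m)) := by
  have b1 := hR.two_lt
  have b3 := hR.lower
  have b5 := hR.le_mul
  zify at b3
  have hmn : m < n := by omega
  rw [closeness_sub_closeness]
  set u : ℤ := n - 1 with hu
  set T1 : Finset (Σ _ : ℕ, ℕ) := (Finset.range p).sigma fun k => Finset.range (k + 1) with hT1
  set T0 : Finset (Σ _ : ℕ, ℕ) := (Finset.range p).sigma fun k => Finset.range k with hT0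
  set w : (Σ _ : ℕ, ℕ) → ℝ := fun j => (1 / 2 : ℝ) ^ (j.1 + 2) with hw
  set P : ℕ → Fin (2 * n + 1) := fun a => circlePoint n (u - a * m) with hP
  set Q : ℕ → Fin (2 * n + 1) := fun b => circlePoint n (u + m + b * m) with hQ
  set E : ℕ → Fin (2 * n + 1) := fun a => circlePoint n (u + n + m - a * m) with hE
  set F : ℕ → Fin (2 * n + 1) := fun b => circlePoint n (u - n + b * m) with hF
  have hmul : ∀ a < p, (0 : ℤ) ≤ a * m ∧ (a * m + m : ℤ) ≤ p * m := by
    intro a ha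
    have := natCast_mul_le m (show a + 1 ≤ p from ha)
    rw [natCast_succ_mul] at this
    exact ⟨by positivity, this⟩
  have hmul1 : ∀ a : ℕ, 1 ≤ a → (m : ℤ) ≤ a * m := fun a ha => by
    simpa using natCast_mul_le m ha
  have hPv : ∀ a < p, ((P a).val : ℤ) = n - 1 - a * m := fun a ha => by
    have := hmul a ha
    exact circlePoint_val_of_mem (by omega) (by omega)
  have hQv : ∀ a < p, ((Q a).val : ℤ) = n - 1 + m + a * m := fun a ha => by
    have := hmul a ha
    exact circlePoint_val_of_mem (by omega) (by omega)
  have hEv : ∀ a < p, 1 ≤ a → ((E a).val : ℤ) = n - 1 + n + m - a * m := fun a ha ha1 => by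
    have := hmul a ha
    have := hmul1 a ha1
    exact circlePoint_val_of_mem (by omega) (by omega)
  have hFv : ∀ a < p, 1 ≤ a → ((F a).val : ℤ) = a * m - 1 := fun a ha ha1 => by
    have := hmul a ha
    have := hmul1 a ha1
    rw [hF]
    simp only
    rw [show u - n + a * m = a * m - 1 by rw [hu]; ring]
    exact circlePoint_val_of_mem (by omega) (by omega)
  have hcancel : ∀ a b : ℕ, (a * m : ℤ) = b * m → a = b := fun a b h => by
    have h' : a * m = b * m := by exact_mod_cast h
    exact Nat.eq_of_mul_eq_mul_right (by omega) h'
  have key := two_mul_sum_le_sum_pairs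
    (fun i => pairCloseness (oddHarary m n) i.1 i.2 -
      pairCloseness (cutHarary m n u (u + m)) i.1 i.2)
    (fun i => sub_nonneg.mpr (pairCloseness_mono (SimpleGraph.deleteEdges_le _) _ _))
    (fun i => by
      simp only [Prod.fst_swap, Prod.snd_swap]
      rw [pairCloseness_comm, pairCloseness_comm (cutHarary m n u (u + m))])
    (T1.disjSum (T0.disjSum T0))
    (Sum.elim (fun j => (P j.2, Q (j.1 - j.2)))
      (Sum.elim (fun j => (Q (j.1 - (j.2 + 1)), E (j.2 + 1)))
        (fun j => (F (j.1 - j.2), P j.2)))) ?_ ?_ (Sum.elim w (Sum.elim w w)) ?_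
  · refine le_trans (le_of_eq ?_) key
    rw [Finset.sum_disjSum, Finset.sum_disjSum]
    simp only [Sum.elim_inl, Sum.elim_inr]
    have s1 : ∑ j ∈ T1, w j = 1 - (p + 2) / 2 * (1 / 2) ^ p := by
      rw [hT1, Finset.sum_sigma, ← sum_succ_mul_half_pow]
      simp [hw]
    have s0 : ∑ j ∈ T0, w j = 1 / 2 - (p + 1) / 2 * (1 / 2) ^ p := by
      rw [hT0, Finset.sum_sigma, ← sum_mul_half_pow]
      simp [hw]
    rw [s1, s0]
    ring
  · have hfirst : ∀ {a b : Fin (2 * n + 1)}, a = b → (a.val : ℤ) = b.val := fun h => by rw [h]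
    -- The families are separated by their first coordinates: every `F` lies below every `P`, and
    -- every `P` below every `Q`.
    rintro (⟨k, a⟩ | ⟨k, a⟩ | ⟨k, a⟩) hj (⟨l, b⟩ | ⟨l, b⟩ | ⟨l, b⟩) hj' h <;>
      simp only [hT1, hT0, Finset.mem_coe, Finset.inl_mem_disjSum, Finset.inr_mem_disjSum,
        Finset.mem_sigma, Finset.mem_range] at hj hj' <;>
      simp only [Sum.elim_inl, Sum.elim_inr, Prod.mk.injEq] at h <;>
      obtain ⟨h1, h2⟩ := h <;> replace h1 := hfirst h1 <;> replace h2 := hfirst h2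
    · rw [hPv _ (by omega), hPv _ (by omega)] at h1
      rw [hQv _ (by omega), hQv _ (by omega)] at h2
      obtain rfl := hcancel a b (by omega)
      have := hcancel (k - a) (l - a) (by omega)
      obtain rfl : k = l := by omega
      rfl
    · exfalso
      rw [hPv _ (by omega), hQv _ (by omega)] at h1
      have := hmul a (by omega)
      have := hmul (l - (b + 1)) (by omega)
      omega
    · exfalso
      rw [hPv _ (by omega), hFv _ (by omega) (by omega)] at h1
      have := hmul a (by omega)
      have := hmul (l - b) (by omega)
      omega
    · exfalso
      rw [hQv _ (by omega), hPv _ (by omega)] at h1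
      have := hmul b (by omega)
      have := hmul (k - (a + 1)) (by omega)
      omega
    · rw [hQv _ (by omega), hQv _ (by omega)] at h1
      rw [hEv _ (by omega) (by omega), hEv _ (by omega) (by omega)] at h2
      have e1 := hcancel (a + 1) (b + 1) (by omega)
      have e2 := hcancel (k - (a + 1)) (l - (b + 1)) (by omega)
      obtain rfl : a = b := by omega
      obtain rfl : k = l := by omega
      rfl
    · exfalso
      rw [hQv _ (by omega), hFv _ (by omega) (by omega)] at h1
      have := hmul (k - (a + 1)) (by omega)
      have := hmul (l - b) (by omega)
      omega
    · exfalso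
      rw [hFv _ (by omega) (by omega), hPv _ (by omega)] at h1
      have := hmul b (by omega)
      have := hmul (k - a) (by omega)
      omega
    · exfalso
      rw [hFv _ (by omega) (by omega), hQv _ (by omega)] at h1
      have := hmul (l - (b + 1)) (by omega)
      have := hmul (k - a) (by omega)
      omega
    · rw [hFv _ (by omega) (by omega), hFv _ (by omega) (by omega)] at h1
      rw [hPv _ (by omega), hPv _ (by omega)] at h2
      obtain rfl := hcancel a b (by omega)
      have := hcancel (k - a) (l - a) (by omega)
      obtain rfl : k = l := by omega
      rfl
  · rintro (⟨k, a⟩ | ⟨k, a⟩ | ⟨k, a⟩) hj <;>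
      simp only [hT1, hT0, Finset.inl_mem_disjSum, Finset.inr_mem_disjSum,
        Finset.mem_sigma, Finset.mem_range] at hj <;>
      simp only [Sum.elim_inl, Sum.elim_inr, Fin.lt_def] <;> zify
    · rw [hPv _ (by omega), hQv _ (by omega)]
      have := hmul a (by omega)
      have := hmul (k - a) (by omega)
      omega
    · rw [hQv _ (by omega), hEv _ (by omega) (by omega)]
      have := hmul (a + 1) (by omega)
      have := hmul (k - (a + 1)) (by omega)
      omega
    · rw [hFv _ (by omega) (by omega), hPv _ (by omega)]
      have := hmul a (by omega)
      have := hmul (k - a) (by omega)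
      omega
  · have hloss : ∀ (x y : Fin (2 * n + 1)) (k l : ℕ), k = l + 1 → (oddHarary m n).Within k x y →
        ¬ (cutHarary m n u (u + m)).Within k x y →
        (1 / 2 : ℝ) ^ (l + 2) ≤ pairCloseness (oddHarary m n) x y -
          pairCloseness (cutHarary m n u (u + m)) x y := by
      rintro x y k l rfl h h'
      have h1 := h.le_pairCloseness
      have h2 := pairCloseness_le_of_not_within h'
      rw [pow_succ _ (l + 1)] at *
      linarith
    rintro (⟨k, a⟩ | ⟨k, a⟩ | ⟨k, a⟩) hj <;>
      simp only [hT1, hT0, Finset.inl_mem_disjSum, Finset.inr_mem_disjSum,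
        Finset.mem_sigma, Finset.mem_range] at hj <;>
      simp only [Sum.elim_inl, Sum.elim_inr, hw]
    · have e : ((a + (k - a) + 1 : ℕ) : ℤ) * m = a * m + ((k - a : ℕ) : ℤ) * m + m := by
        push_cast; ring
      have ha0 : (0 : ℤ) ≤ a * m := by positivity
      have hb0 : (0 : ℤ) ≤ ((k - a : ℕ) : ℤ) * m := by positivity
      exact hloss _ _ (a + (k - a) + 1) k (by omega)
        (within_circle_of_abs (fun z s => oddHarary_adj_circle (m := m) (n := n) hmn.le z) _ _ _
          (by rw [e]; omega) (by rw [e]; omega))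
        (cutHarary_not_within_circle hR (by omega) (by omega) (by omega))
    · exact hloss _ _ (a + 1 + (k - (a + 1)) + 1) k (by omega)
        (oddHarary_within_far hR (by omega) (by omega) (by omega))
        (cutHarary_not_within_far hR (by omega) (by omega) (by omega))
    · rw [pairCloseness_comm, pairCloseness_comm (cutHarary m n u (u + m))]
      exact hloss _ _ (a + (k - a) + 1) k (by omega)
        (oddHarary_within_near hR (by omega) (by omega) (by omega))
        (cutHarary_not_within_near hR (by omega) (by omega) (by omega))

/-- No link of the Harary graph costs more than `4 - (3 * p + 4) * 2⁻ᵖ`. -/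
theorem closeness_sub_deleteEdges_le (hR : HararyRange m n p) {e : Sym2 (Fin (2 * n + 1))}
    (he : e ∈ (oddHarary m n).edgeSet) :
    closeness (oddHarary m n) - closeness ((oddHarary m n).deleteEdges {e}) ≤
      4 - (3 * p + 4) * (1 / 2 : ℝ) ^ p := by
  have b1 := hR.two_lt
  have b3 := hR.lower
  have b5 := hR.le_mul
  zify at b3
  have hmn : m < n := by omega
  induction e using Sym2.ind with
  | _ x y =>
    rw [SimpleGraph.mem_edgeSet] at he
    obtain ⟨z, hz0, hz1, rfl⟩ := exists_eq_circlePoint x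
    have hval := circlePoint_val_of_mem hz0 hz1
    obtain ⟨s, hy, hs0, ⟨h1, h2⟩ | ⟨rfl, h⟩ | ⟨rfl, h⟩⟩ := oddHarary_adj_cases hmn.le he
    · rcases lt_or_gt_of_ne hs0 with hneg | hpos
      · obtain ⟨w, hw0, hw1, rfl⟩ := exists_eq_circlePoint y
        have hz : circlePoint n z = circlePoint n (w + -s) := by
          rw [circlePoint_eq_iff] at hy ⊢
          obtain ⟨c, hc⟩ := hy
          exact ⟨-c, by linear_combination -hc⟩
        rw [Sym2.eq_swap, hz]
        exact closeness_sub_cut_le hR hw0 hw1 (by omega) (by omega)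
      · rw [hy]
        exact closeness_sub_cut_le hR hz0 hz1 hpos h2
    · rw [hy]
      exact closeness_sub_long_cut_le hR hz0 (by omega)
    · have hy' : y = circlePoint n (z - n) := by
        rw [hy]
        exact circlePoint_congr (-1) (by ring)
      have := closeness_sub_long_cut_le (u := z - n) hR (by omega) (by omega)
      rw [sub_add_cancel] at this
      rw [Sym2.eq_swap, hy']
      exact this

end Extremal

/-- The link residual closeness of the odd-odd Harary graphs `H_{2m+1,2n+1}`, `m > 2`, and a link
whose removal attains the minimum. -/
theorem theorem8 (m n p : ℕ) (hm : 2 < m) (hp : p = (n + m - 1) / (2 * m)) (hp1 : 1 < p) :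
    linkResidualCloseness (hararyGraph (2 * m + 1) (2 * n + 1)) =
        closeness (hararyGraph (2 * m + 1) (2 * n + 1)) - 4
          + (3 * (p : ℝ) + 4) * (2 : ℝ) ^ (-(p : ℤ)) ∧
      ∃ u v : Fin (2 * n + 1), vertexLabel u = n ∧ vertexLabel v = n + m ∧
        (hararyGraph (2 * m + 1) (2 * n + 1)).Adj u v ∧
        closeness ((hararyGraph (2 * m + 1) (2 * n + 1)).deleteEdges {s(u, v)}) =
          linkResidualCloseness (hararyGraph (2 * m + 1) (2 * n + 1)) := by
  -- The bounds unfold the floor. With `p ≥ 2` they give `n ≥ 3m + 1`, hence `m < n`.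
  have hR : HararyRange m n p := by
    have h1 : (n + m - 1) / (2 * m) * (2 * m) ≤ n + m - 1 := Nat.div_mul_le_self _ _
    have h2 : n + m - 1 < 2 * m * ((n + m - 1) / (2 * m) + 1) :=
      Nat.lt_mul_div_succ _ (by omega)
    rw [← hp] at h1 h2
    have e1 : p * (2 * m) = 2 * (p * m) := by ring
    have e2 : 2 * m * (p + 1) = 2 * (p * m) + 2 * m := by ring
    exact ⟨hm, hp1, by omega, by omega⟩
  have b3 := hR.lower
  have b5 := hR.le_mul
  zify at b3
  have hadj := oddHarary_adj_circle (m := m) (n := n) (s := m) (by omega) (n - 1) (by omega) le_rfl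
  have hpow : (2 : ℝ) ^ (-(p : ℤ)) = (1 / 2) ^ p := by simp [zpow_neg]
  have hle := closeness_sub_cut_le (u := n - 1) (r := m) hR (by omega) (by omega) (by omega) le_rfl
  have hge := le_closeness_sub_cut hR
  have hmin : linkResidualCloseness (oddHarary m n) =
      closeness (cutHarary m n (n - 1) (n - 1 + m)) := by
    refine IsLeast.csInf_eq ⟨⟨_, hadj, rfl⟩, ?_⟩
    rintro c ⟨e, he, rfl⟩
    have := closeness_sub_deleteEdges_le hR he
    linarith
  -- Positions count from 0 and labels from 1, so these vertices carry the labels `n` and `n + m`.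
  refine ⟨?_, circlePoint n (n - 1), circlePoint n (n - 1 + m), ?_, ?_, hadj, hmin.symm⟩
  · rw [hpow]
    refine hmin.trans ?_
    linarith
  · have := circlePoint_val_of_mem (n := n) (z := n - 1) (by omega) (by omega)
    simp only [vertexLabel]
    omega
  · have := circlePoint_val_of_mem (n := n) (z := n - 1 + m) (by omega) (by omega)
    simp only [vertexLabel]
    omega
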